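/- A metric graph $\Gamma$ is a (possibly infinite) connected undirected graph, with multiple edges and loops allowed, in which every edge with endpoints $v,w$ is identified with an interval (or, if $v=w$, a circle) of length $a_{v,w}>0$, such that $a_\Gamma:=\inf a_{v,w}>0$, the infimum being over the pairs $v\neq w$ joined by an edge ($a_\Gamma=+\infty$ if there are none); the distance of two points of $\Gamma$ is the infimum of the lengths of the paths joining them. For a finite Borel measure $\nu$ on a metric space, let $\mathrm{diam}(\nu,\alpha)$ be the infimum of the diameters of the Borel sets of $\nu$-measure at least $\alpha$, and let $\mathrm{Sep}(\nu;\kappa_1,\kappa_2)$ be the supremum of the distances $d(A,B)$ over non-empty Borel sets $A,B$ with $\nu(A)\ge\kappa_1$ and $\nu(B)\ge\kappa_2$. Theorem. Let $\nu$ be a finite Borel measure on a metric graph $\Gamma$ with $m:=\nu(\Gamma)$, concentrated on a separable subset (which is automatic if $\Gamma$ is separable, e.g. if it has countably many edges). Assume that positive numbers $a,\kappa,\kappa'$ satisfy $\kappa'<\kappa$, $a<a_\Gamma$, and $$\max\Big\{2\,\mathrm{Sep}\Big(\nu;\frac{\kappa}{3},\frac{\kappa}{3}\Big),\ 4\,\mathrm{Sep}\Big(\nu;\frac{m-\kappa}{3},\kappa'\Big)\Big\}<a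 .$$ Then $$\mathrm{diam}(\nu,m-\kappa)\le\max\Big\{\frac a2+2\,\mathrm{Sep}\Big(\nu;\frac{\kappa}{3},\kappa\Big),\ \frac{\pi}{\sqrt2}\,\mathrm{Sep}\Big(\nu;\frac{\kappa-\kappa'}{4},\frac{\kappa-\kappa'}{4}\Big)\Big\}.$$ -/

import Mathlib

open MeasureTheory Set
open scoped ENNReal

noncomputable section

/-- The data of a metric graph: a connected undirected multigraph with vertex set `V` and edge
set `E` (multiple edges and loops are allowed), together with edge lengths `a s(v, w)` that depend
on the endpoints.  The endpoints of an edge are listed as `src e`, `tgt e` only in order to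
parametrize the edge; this order plays no other role. -/
structure MetricGraph (V : Type*) (E : Type*) where
  /-- the first endpoint of an edge -/
  src : E → V
  /-- the second endpoint of an edge (equal to the first one for a loop) -/
  tgt : E → V
  /-- the lengths; only the values at pairs of endpoints of edges matter -/
  a : Sym2 V → ℝ
  a_pos : ∀ e, 0 < a s(src e, tgt e)
  /-- the infimum of the lengths of the edges with distinct endpoints is positive -/
  inf_pos : 0 < ⨅ (e : E) (_ : src e ≠ tgt e), ENNReal.ofReal (a s(src e, tgt e))
  /-- any two vertices are joined by a walk along edges -/
  connected : ∀ v w, Relation.EqvGen (fun x y => ∃ e, src e = x ∧ tgt e = y) v w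

namespace MetricGraph

variable {V E : Type*} (G : MetricGraph V E)

/-- The length of an edge. -/
def len (e : E) : ℝ := G.a s(G.src e, G.tgt e)

/-- The infimum of the lengths `a_{v,w}` over pairs `v ≠ w` joined by an edge
(it is `∞` if all edges are loops). -/
def minLen : ℝ≥0∞ :=
  ⨅ (e : E) (_ : G.src e ≠ G.tgt e), ENNReal.ofReal (G.a s(G.src e, G.tgt e))

/-- The points of the metric graph: the vertices and, for each edge `e`, an open interval
`(0, len e)` of interior points. -/
inductive Point (G : MetricGraph V E) : Type _
  | vertex (v : V) : Point G
  | inner (e : E) (s : ℝ) (h : 0 < s ∧ s < G.len e) : Point G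

open Classical in
/-- The arc length parametrization of the closed edge `e` by `[0, len e]`: the end `0` is glued to
`src e`, the end `len e` to `tgt e`.  So an edge with distinct endpoints is an interval and
a loop is a circle. -/
def onEdge (e : E) (s : ℝ) : G.Point :=
  if h : 0 < s ∧ s < G.len e then .inner e s h
  else if s ≤ 0 then .vertex (G.src e) else .vertex (G.tgt e)

/-- `G.HasPath x y ℓ`: there is a path from `x` to `y` of length `ℓ` which is composed of finitely
many segments, each running inside one closed edge `e` from parameter `s` to parameter `t`. -/
inductive HasPath : G.Point → G.Point → ℝ → Prop
  | refl (x : G.Point) : HasPath x x 0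
  | cons (e : E) (s t : ℝ) (hs : s ∈ Icc 0 (G.len e)) (ht : t ∈ Icc 0 (G.len e))
      (y : G.Point) (l : ℝ) (h : HasPath (G.onEdge e t) y l) :
      HasPath (G.onEdge e s) y (|s - t| + l)

variable {G}

theorem len_pos (e : E) : 0 < G.len e := G.a_pos e

theorem onEdge_zero (e : E) : G.onEdge e 0 = .vertex (G.src e) := by
  simp [onEdge]

theorem onEdge_len (e : E) : G.onEdge e (G.len e) = .vertex (G.tgt e) := by
  have := len_pos (G := G) e
  simp [onEdge, this]

theorem onEdge_inner (e : E) (s : ℝ) (h : 0 < s ∧ s < G.len e) :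
    G.onEdge e s = .inner e s h := by
  simp [onEdge, h]

theorem HasPath.nonneg {x y : G.Point} {l : ℝ} (h : G.HasPath x y l) : 0 ≤ l := by
  induction h with
  | refl => exact le_rfl
  | cons e s t hs ht y l h ih => positivity

theorem HasPath.trans {x y z : G.Point} {l l' : ℝ} (h : G.HasPath x y l) (h' : G.HasPath y z l') :
    G.HasPath x z (l + l') := by
  induction h with
  | refl => simpa using h'
  | cons e s t hs ht y l h ih =>
    rw [add_assoc]
    exact .cons e s t hs ht _ _ (ih h')

theorem HasPath.segment (e : E) {s t : ℝ} (hs : s ∈ Icc 0 (G.len e)) (ht : t ∈ Icc 0 (G.len e)) :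
    G.HasPath (G.onEdge e s) (G.onEdge e t) |s - t| := by
  simpa using HasPath.cons e s t hs ht _ _ (HasPath.refl _)

theorem HasPath.symm {x y : G.Point} {l : ℝ} (h : G.HasPath x y l) : G.HasPath y x l := by
  induction h with
  | refl x => exact .refl x
  | cons e s t hs ht y l h ih =>
    rw [add_comm, abs_sub_comm]
    exact ih.trans (HasPath.segment e ht hs)

theorem exists_hasPath_vertex (v w : V) :
    ∃ l, G.HasPath (.vertex v) (.vertex w) l := by
  induction G.connected v w with
  | rel x y h =>
    obtain ⟨e, rfl, rfl⟩ := h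
    have h0 := len_pos (G := G) e
    refine ⟨|0 - G.len e|, ?_⟩
    rw [← onEdge_zero, ← onEdge_len]
    exact HasPath.segment e ⟨le_rfl, h0.le⟩ ⟨h0.le, le_rfl⟩
  | refl x => exact ⟨0, .refl _⟩
  | symm x y _ ih => exact ⟨_, ih.choose_spec.symm⟩
  | trans x y z _ _ ih ih' => exact ⟨_, ih.choose_spec.trans ih'.choose_spec⟩

theorem exists_hasPath_to_vertex (x : G.Point) : ∃ v l, G.HasPath x (.vertex v) l := by
  cases x with
  | vertex v => exact ⟨v, 0, .refl _⟩
  | inner e s h =>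
    have h0 := len_pos (G := G) e
    refine ⟨G.src e, |s - 0|, ?_⟩
    rw [← onEdge_zero, ← onEdge_inner e s h]
    exact HasPath.segment e ⟨h.1.le, h.2.le⟩ ⟨le_rfl, h0.le⟩

theorem exists_hasPath (x y : G.Point) : ∃ l, G.HasPath x y l := by
  obtain ⟨v, l, hl⟩ := exists_hasPath_to_vertex x
  obtain ⟨w, l', hl'⟩ := exists_hasPath_to_vertex y
  obtain ⟨l'', hl''⟩ := exists_hasPath_vertex (G := G) v w
  exact ⟨_, (hl.trans hl'').trans hl'.symm⟩

/-- A function that is `1`-Lipschitz along each edge bounds path lengths from below. -/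
theorem HasPath.abs_sub_le {f : G.Point → ℝ}
    (hf : ∀ e, ∀ s ∈ Icc 0 (G.len e), ∀ t ∈ Icc 0 (G.len e),
      |f (G.onEdge e s) - f (G.onEdge e t)| ≤ |s - t|)
    {x y : G.Point} {l : ℝ} (h : G.HasPath x y l) : |f x - f y| ≤ l := by
  induction h with
  | refl => simp
  | cons e s t hs ht y l h ih =>
    exact (_root_.abs_sub_le _ (f (G.onEdge e t)) _).trans (add_le_add (hf e s hs t ht) ih)

/-- Two distinct points are told apart by a function that is `1`-Lipschitz along each edge. -/
theorem exists_separating_inner (e : E) (s : ℝ) (h : 0 < s ∧ s < G.len e) (y : G.Point)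
    (hy : y ≠ .inner e s h) :
    ∃ f : G.Point → ℝ, (∀ e, ∀ s ∈ Icc 0 (G.len e), ∀ t ∈ Icc 0 (G.len e),
      |f (G.onEdge e s) - f (G.onEdge e t)| ≤ |s - t|) ∧ f y ≠ f (.inner e s h) := by
  classical
  set r := min s (G.len e - s) with hr
  have hr0 : 0 < r := lt_min h.1 (by linarith [h.2])
  have hrs : r ≤ s := min_le_left _ _
  have hrl : r ≤ G.len e - s := min_le_right _ _
  let f : G.Point → ℝ := fun p => match p with
    | .vertex _ => 0
    | .inner e' s' _ => if e' = e then max 0 (r - |s' - s|) else 0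
  have key : ∀ e', ∀ t ∈ Icc 0 (G.len e'),
      f (G.onEdge e' t) = if e' = e then max 0 (r - |t - s|) else 0 := by
    intro e' t ht
    by_cases hi : 0 < t ∧ t < G.len e'
    · rw [onEdge_inner e' t hi]
    · have h1 : f (G.onEdge e' t) = 0 := by
        unfold onEdge
        rw [dif_neg hi]
        split_ifs <;> rfl
      rw [h1]
      split_ifs with he
      · subst he
        symm
        apply max_eq_left
        rcases eq_or_lt_of_le ht.1 with h0 | h0
        · have := neg_abs_le (t - s)
          linarith
        · have h2 : G.len e' ≤ t := not_lt.1 fun h3 => hi ⟨h0, h3⟩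
          have := le_abs_self (t - s)
          linarith
      · rfl
  refine ⟨f, ?_, ?_⟩
  · intro e' t ht u hu
    rw [key e' t ht, key e' u hu]
    split_ifs
    · have h1 := abs_max_sub_max_le_abs (r - |t - s|) (r - |u - s|) 0
      rw [max_comm 0, max_comm 0]
      refine h1.trans ?_
      have h2 : r - |t - s| - (r - |u - s|) = |u - s| - |t - s| := by ring
      rw [h2, abs_sub_comm t u]
      refine (abs_abs_sub_abs_le_abs_sub _ _).trans (le_of_eq ?_)
      congr 1
      ring
    · simp
  · have hx : f (.inner e s h) = r := by
      change (if e = e then max 0 (r - |s - s|) else 0) = r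
      simp [hr0.le]
    rw [hx]
    cases y with
    | vertex v => exact hr0.ne
    | inner e' s' h' =>
      change (if e' = e then max 0 (r - |s' - s|) else 0) ≠ r
      split_ifs with he
      · subst he
        have hne : s' ≠ s := by
          rintro rfl
          exact hy rfl
        have : 0 < |s' - s| := abs_pos.2 (sub_ne_zero.2 hne)
        exact (max_lt hr0 (by linarith)).ne
      · exact hr0.ne

theorem exists_separating_vertex (v w : V) (hvw : v ≠ w) :
    ∃ f : G.Point → ℝ, (∀ e, ∀ s ∈ Icc 0 (G.len e), ∀ t ∈ Icc 0 (G.len e),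
      |f (G.onEdge e s) - f (G.onEdge e t)| ≤ |s - t|) ∧ f (.vertex v) ≠ f (.vertex w) := by
  classical
  obtain ⟨c, hc0, hc⟩ : ∃ c : ℝ, 0 < c ∧ ∀ e, G.src e ≠ G.tgt e → c ≤ G.len e := by
    obtain ⟨c, hc0, hc⟩ := ENNReal.lt_iff_exists_nnreal_btwn.1 G.inf_pos
    refine ⟨c, by exact_mod_cast hc0, fun e he => ?_⟩
    have h1 : (c : ℝ≥0∞) ≤ ENNReal.ofReal (G.len e) := hc.le.trans (iInf₂_le e he)
    have h2 := ENNReal.toReal_mono ENNReal.ofReal_ne_top h1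
    rwa [ENNReal.toReal_ofReal (len_pos e).le] at h2
  let g : V → ℝ := fun u => if u = v then 0 else c
  let f : G.Point → ℝ := fun p => match p with
    | .vertex u => g u
    | .inner e s _ => g (G.src e) + (g (G.tgt e) - g (G.src e)) * (s / G.len e)
  have key : ∀ e, ∀ t ∈ Icc 0 (G.len e),
      f (G.onEdge e t) = g (G.src e) + (g (G.tgt e) - g (G.src e)) * (t / G.len e) := by
    intro e t ht
    have h0 := len_pos (G := G) e
    by_cases hi : 0 < t ∧ t < G.len e
    · rw [onEdge_inner e t hi]
    · rcases eq_or_lt_of_le ht.1 with h1 | h1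
      · subst h1
        rw [onEdge_zero]
        simp [f]
      · have h2 : t = G.len e := le_antisymm ht.2 (not_lt.1 fun h3 => hi ⟨h1, h3⟩)
        subst h2
        rw [onEdge_len, div_self h0.ne']
        simp [f]
  refine ⟨f, ?_, ?_⟩
  · intro e s hs t ht
    have h0 := len_pos (G := G) e
    rw [key e s hs, key e t ht]
    have h1 : |g (G.tgt e) - g (G.src e)| ≤ G.len e := by
      by_cases he : G.src e = G.tgt e
      · simp [he, h0.le]
      · refine le_trans ?_ (hc e he)
        by_cases h2 : G.tgt e = v <;> by_cases h3 : G.src e = v <;>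
          simp [g, h2, h3, abs_of_pos hc0, hc0.le]
    have h2 : g (G.src e) + (g (G.tgt e) - g (G.src e)) * (s / G.len e) -
        (g (G.src e) + (g (G.tgt e) - g (G.src e)) * (t / G.len e)) =
        (g (G.tgt e) - g (G.src e)) * ((s - t) / G.len e) := by ring
    rw [h2, abs_mul, abs_div, abs_of_pos h0]
    calc _ ≤ G.len e * (|s - t| / G.len e) := by gcongr
      _ = |s - t| := by field_simp
  · have h1 : f (.vertex v) = 0 := by simp [f, g]
    have h2 : f (.vertex w) = c := by simp [f, g, hvw.symm]
    rw [h1, h2]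
    exact hc0.ne

theorem exists_separating (x y : G.Point) (hxy : x ≠ y) :
    ∃ f : G.Point → ℝ, (∀ e, ∀ s ∈ Icc 0 (G.len e), ∀ t ∈ Icc 0 (G.len e),
      |f (G.onEdge e s) - f (G.onEdge e t)| ≤ |s - t|) ∧ f x ≠ f y := by
  cases x with
  | inner e s h =>
    obtain ⟨f, hf, hne⟩ := exists_separating_inner e s h y hxy.symm
    exact ⟨f, hf, hne.symm⟩
  | vertex v =>
    cases y with
    | inner e s h => exact exists_separating_inner e s h _ hxy
    | vertex w =>
      refine exists_separating_vertex v w ?_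
      rintro rfl
      exact hxy rfl

theorem bddBelow_lengths (x y : G.Point) : BddBelow {l | G.HasPath x y l} :=
  ⟨0, fun _ h => HasPath.nonneg h⟩

/-- The distance of two points is the infimum of the lengths of the paths joining them. -/
instance : MetricSpace G.Point where
  dist x y := sInf {l | G.HasPath x y l}
  dist_self x :=
    le_antisymm (csInf_le (bddBelow_lengths x x) (HasPath.refl x))
      (le_csInf ⟨0, HasPath.refl x⟩ fun _ h => HasPath.nonneg h)
  dist_comm x y := by
    congr 1
    ext l
    exact ⟨HasPath.symm, HasPath.symm⟩
  dist_triangle x y z := by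
    refine le_of_forall_pos_lt_add fun ε hε => ?_
    obtain ⟨l, hl, hl'⟩ := exists_lt_of_csInf_lt (exists_hasPath x y)
      (lt_add_of_pos_right (sInf {l | G.HasPath x y l}) (half_pos hε))
    obtain ⟨k, hk, hk'⟩ := exists_lt_of_csInf_lt (exists_hasPath y z)
      (lt_add_of_pos_right (sInf {l | G.HasPath y z l}) (half_pos hε))
    have h := csInf_le (bddBelow_lengths x z) (HasPath.trans hl hk)
    linarith
  eq_of_dist_eq_zero {x y} h := by
    by_contra hne
    obtain ⟨f, hf, hfne⟩ := exists_separating x y hne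
    have h1 : |f x - f y| ≤ sInf {l | G.HasPath x y l} :=
      le_csInf (exists_hasPath x y) fun _ hl => HasPath.abs_sub_le hf hl
    have h2 : 0 < |f x - f y| := abs_pos.2 (sub_ne_zero.2 hfne)
    exact absurd (h2.trans_le h1) (by rw [show sInf {l | G.HasPath x y l} = 0 from h]; simp)

instance : MeasurableSpace G.Point := borel G.Point

instance : BorelSpace G.Point := ⟨rfl⟩

end MetricGraph

section Invariants

variable {X : Type*} [MetricSpace X] [MeasurableSpace X]

/-- The distance between two subsets. -/
def setDist (A B : Set X) : ℝ≥0∞ := ⨅ (x ∈ A) (y ∈ B), edist x y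

/-- The separation distance `Sep(ν; κ₁, κ₂)`: the supremum of the distances between (non-empty)
measurable sets of measure at least `κ₁` and `κ₂`. -/
def sepDist (ν : Measure X) (κ₁ κ₂ : ℝ) : ℝ≥0∞ :=
  ⨆ (A : Set X) (B : Set X)
    (_ : MeasurableSet A ∧ A.Nonempty ∧ ENNReal.ofReal κ₁ ≤ ν A)
    (_ : MeasurableSet B ∧ B.Nonempty ∧ ENNReal.ofReal κ₂ ≤ ν B), setDist A B

/-- The partial diameter `diam(ν, α)`: the infimum of the diameters of the measurable sets of
measure at least `α`. -/
def partialDiam (ν : Measure X) (α : ℝ) : ℝ≥0∞ :=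
  ⨅ (Y : Set X) (_ : MeasurableSet Y) (_ : ENNReal.ofReal α ≤ ν Y), Metric.ediam Y

end Invariants

end

/-! ### Distance estimates in a metric graph. -/

namespace MetricGraph

variable {V E : Type*} {G : MetricGraph V E}

/-! Write δ = m - κ. The closed balls of radius a/4 about the vertices and the middle parts of the
edges (points of an open edge further than a/4 from both ends) cover Γ. Distinct vertices are at
least a apart, so two disjoint collections of such pieces are at distance at least a/2 as soon as no
edge of one has an end among the vertices of the other (`half_le_dist_part`). The measure thus
becomes a weighting of the vertices and edges of a multigraph, and a separation distance below a/2
says that two such collections cannot both be heavy (`sum_lt_of_separated`). Concentration on a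
separable set reduces everything to finitely many pieces, up to ε.

Suppose the bound fails. A ball of mass at least κ/3 would grow, by little more than Sep(κ/3, κ), to
a ball missing less than κ; hence every ball is lighter than κ/3. If a middle part had mass at least
δ/3, the complement of its open edge would have mass below κ'. An open edge embeds isometrically
into a circle; cutting off the two tails of mass (κ-κ')/4 in each of the coordinates cosine and
sine, and comparing arc with chord, would give the second term of the maximum
(`partialDiam_le_of_openEdge`). Hence every middle part is lighter than δ/3.

If all balls are lighter than δ/3 too, the multigraph has only light pieces and can be cut into two
separated parts of mass at least κ/3 (`false_of_no_separated_parts`), against Sep(κ/3, κ/3) < a/2.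
If some ball has mass at least δ/3, then the partial diameter is at most a, the failure of the bound
yields Sep((κ-κ')/4, (κ-κ')/4) < a/2, and bounding vertices and edges separately leaves too little
total mass (`sum_add_sum_lt_of_heavy_vertex`). -/

theorem dist_le_of_hasPath {x y : G.Point} {l : ℝ} (h : G.HasPath x y l) : dist x y ≤ l :=
  csInf_le (bddBelow_lengths x y) h

theorem dist_onEdge_le (e : E) {s t : ℝ} (hs : s ∈ Icc 0 (G.len e)) (ht : t ∈ Icc 0 (G.len e)) :
    dist (G.onEdge e s) (G.onEdge e t) ≤ |s - t| :=
  dist_le_of_hasPath (HasPath.segment e hs ht)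

/-- A function that is `1`-Lipschitz along each edge is `1`-Lipschitz. -/
theorem abs_sub_le_dist {f : G.Point → ℝ}
    (hf : ∀ e, ∀ s ∈ Icc 0 (G.len e), ∀ t ∈ Icc 0 (G.len e),
      |f (G.onEdge e s) - f (G.onEdge e t)| ≤ |s - t|) (x y : G.Point) :
    |f x - f y| ≤ dist x y :=
  le_csInf (exists_hasPath x y) fun _ hl => HasPath.abs_sub_le hf hl

theorem dist_inner_src_le (e : E) (s : ℝ) (h : 0 < s ∧ s < G.len e) :
    dist (Point.inner e s h : G.Point) (.vertex (G.src e)) ≤ s := by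
  have := dist_onEdge_le (G := G) e ⟨h.1.le, h.2.le⟩ ⟨le_rfl, (len_pos e).le⟩
  rwa [onEdge_zero, onEdge_inner e s h, sub_zero, abs_of_pos h.1] at this

theorem dist_inner_tgt_le (e : E) (s : ℝ) (h : 0 < s ∧ s < G.len e) :
    dist (Point.inner e s h : G.Point) (.vertex (G.tgt e)) ≤ G.len e - s := by
  have := dist_onEdge_le (G := G) e ⟨h.1.le, h.2.le⟩ ⟨(len_pos e).le, le_rfl⟩
  rwa [onEdge_len, onEdge_inner e s h, abs_sub_comm, abs_of_pos (by linarith [h.2])] at this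

theorem dist_inner_le (e : E) (s t : ℝ) (hs : 0 < s ∧ s < G.len e) (ht : 0 < t ∧ t < G.len e) :
    dist (Point.inner e s hs : G.Point) (.inner e t ht) ≤ |s - t| := by
  have := dist_onEdge_le (G := G) e ⟨hs.1.le, hs.2.le⟩ ⟨ht.1.le, ht.2.le⟩
  rwa [onEdge_inner e s hs, onEdge_inner e t ht] at this

theorem dist_src_tgt_le (e : E) :
    dist (.vertex (G.src e) : G.Point) (.vertex (G.tgt e)) ≤ G.len e := by
  have := dist_onEdge_le (G := G) e ⟨le_rfl, (len_pos e).le⟩ ⟨(len_pos e).le, le_rfl⟩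
  rwa [onEdge_len, onEdge_zero, zero_sub, abs_neg, abs_of_pos (len_pos e)] at this

/-- The open edge `e`. -/
def openEdge (G : MetricGraph V E) (e : E) : Set G.Point := {x | ∃ s h, x = .inner e s h}

theorem onEdge_cases (e : E) {s : ℝ} (hs : s ∈ Icc 0 (G.len e)) :
    s = 0 ∨ s = G.len e ∨ ∃ h : 0 < s ∧ s < G.len e, G.onEdge e s = .inner e s h := by
  rcases hs.1.eq_or_lt with h | h
  · exact .inl h.symm
  rcases hs.2.eq_or_lt with h' | h'
  · exact .inr (.inl h')
  · exact .inr (.inr ⟨⟨h, h'⟩, onEdge_inner e s ⟨h, h'⟩⟩)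

theorem vertex_notMem_openEdge (v : V) (e : E) : (.vertex v : G.Point) ∉ G.openEdge e := by
  rintro ⟨s, h, hx⟩
  cases hx

theorem onEdge_notMem_openEdge {e f : E} (hef : f ≠ e) {s : ℝ} (hs : s ∈ Icc 0 (G.len f)) :
    G.onEdge f s ∉ G.openEdge e := by
  rcases onEdge_cases f hs with rfl | rfl | ⟨h, h'⟩
  · rw [onEdge_zero]; exact vertex_notMem_openEdge _ _
  · rw [onEdge_len]; exact vertex_notMem_openEdge _ _
  · rw [h']
    rintro ⟨t, ht, hx⟩
    cases hx
    exact hef rfl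

open Classical in
/-- Modify a function along the open edge `e`. -/
noncomputable def modify (e : E) (g : ℝ → ℝ) (F : G.Point → ℝ) : G.Point → ℝ
  | .vertex v => F (.vertex v)
  | .inner f s h => if f = e then g s else F (.inner f s h)

theorem modify_of_notMem (e : E) (g : ℝ → ℝ) (F : G.Point → ℝ) {x : G.Point}
    (hx : x ∉ G.openEdge e) : modify e g F x = F x := by
  cases x with
  | vertex v => rfl
  | inner f s h =>
    refine if_neg ?_
    rintro rfl
    exact hx ⟨s, h, rfl⟩

theorem modify_inner (e : E) (g : ℝ → ℝ) (F : G.Point → ℝ) (s : ℝ) (h : 0 < s ∧ s < G.len e) :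
    modify e g F (.inner e s h) = g s := if_pos rfl

/-- Glueing of `1`-Lipschitz functions on an open edge and on its complement. -/
theorem modify_sub_le_dist (e : E) (g : ℝ → ℝ) (F : G.Point → ℝ)
    (hg : ∀ s t, |g s - g t| ≤ |s - t|) (hF : ∀ x y, |F x - F y| ≤ dist x y)
    (h0 : g 0 = F (.vertex (G.src e))) (h1 : g (G.len e) = F (.vertex (G.tgt e)))
    (x y : G.Point) : |modify e g F x - modify e g F y| ≤ dist x y := by
  refine abs_sub_le_dist (fun f s hs t ht => ?_) x y
  by_cases hfe : f = e
  · subst hfe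
    have key : ∀ s ∈ Icc 0 (G.len f), modify f g F (G.onEdge f s) = g s := by
      intro s hs
      rcases onEdge_cases f hs with rfl | rfl | ⟨h, h'⟩
      · rw [onEdge_zero, h0]; rfl
      · rw [onEdge_len, h1]; rfl
      · rw [h', modify_inner]
    rw [key s hs, key t ht]
    exact hg s t
  · rw [modify_of_notMem _ _ _ (onEdge_notMem_openEdge hfe hs),
      modify_of_notMem _ _ _ (onEdge_notMem_openEdge hfe ht)]
    exact (hF _ _).trans (dist_onEdge_le f hs ht)

theorem abs_min_sub_min_le {a b c d r : ℝ} (h1 : |a - c| ≤ r) (h2 : |b - d| ≤ r) :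
    |min a b - min c d| ≤ r :=
  (abs_min_sub_min_le_max a b c d).trans (max_le h1 h2)

/-- A path from an inner point of `e` to a point outside passes through an end of `e`. -/
theorem min_le_dist_inner (e : E) (s : ℝ) (h : 0 < s ∧ s < G.len e) {y : G.Point}
    (hy : y ∉ G.openEdge e) :
    min (s + dist (.vertex (G.src e)) y) (G.len e - s + dist (.vertex (G.tgt e)) y) ≤
      dist (.inner e s h) y := by
  have hd := dist_src_tgt_le (G := G) e
  have h2 := dist_triangle (.vertex (G.src e) : G.Point) (.vertex (G.tgt e)) y
  have h3 := dist_triangle (.vertex (G.tgt e) : G.Point) (.vertex (G.src e)) y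
  rw [dist_comm (.vertex (G.tgt e) : G.Point) (.vertex (G.src e))] at h3
  -- The distance to `y`, with the shorter route through an end prescribed on the open edge. The two
  -- formulas match at the ends because these are at most `len e` apart.
  have := modify_sub_le_dist e
    (fun s => min (s + dist (.vertex (G.src e)) y) (G.len e - s + dist (.vertex (G.tgt e)) y))
    (fun x => dist x y) (fun s t => abs_min_sub_min_le (by simp) (by
      rw [abs_sub_comm s t]; exact le_of_eq (by congr 1; ring)))
    (fun x z => abs_dist_sub_le x z y)
    (by rw [min_eq_left (by linarith), zero_add])
    (by rw [min_eq_right (by linarith), sub_self, zero_add]) (.inner e s h) y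
  rw [modify_inner, modify_of_notMem _ _ _ hy, dist_self, sub_zero] at this
  exact (le_abs_self _).trans this

/-- Lower bound for the distance of two points of an open edge. -/
theorem min_le_dist_inner_inner (e : E) (s t : ℝ) (hs : 0 < s ∧ s < G.len e)
    (ht : 0 < t ∧ t < G.len e) :
    min |s - t| (G.len e + dist (.vertex (G.src e) : G.Point) (.vertex (G.tgt e)) - |s - t|) ≤
      dist (.inner e s hs : G.Point) (.inner e t ht) := by
  set D := dist (.vertex (G.src e) : G.Point) (.vertex (G.tgt e)) with hD
  have hd : D ≤ G.len e := dist_src_tgt_le (G := G) e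
  have hD0 : 0 ≤ D := dist_nonneg
  have habs : ∀ a b : ℝ, |(|s - a| - |s - b|)| ≤ |a - b| := fun a b => by
    refine (abs_abs_sub_abs_le_abs_sub _ _).trans (le_of_eq ?_)
    rw [abs_sub_comm a b]; congr 1; ring
  -- A candidate for the distance from the point `s`: on the edge, the shorter arc of a circle of
  -- circumference `len e + D`; elsewhere, the shorter route through an end.
  have := modify_sub_le_dist e
    (fun t => min |s - t| (G.len e + D - |s - t|))
    (fun x => min (s + dist (.vertex (G.src e)) x) (G.len e - s + dist (.vertex (G.tgt e)) x))
    (fun a b => abs_min_sub_min_le (habs a b) (by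
      rw [abs_sub_comm]; refine le_trans (le_of_eq ?_) (habs a b); congr 1; ring))
    (fun x z => abs_min_sub_min_le
      (by
        rw [add_sub_add_left_eq_sub, dist_comm _ x, dist_comm _ z]
        exact abs_dist_sub_le x z _)
      (by
        rw [add_sub_add_left_eq_sub, dist_comm _ x, dist_comm _ z]
        exact abs_dist_sub_le x z _))
    (by
      rw [dist_self, dist_comm (.vertex (G.tgt e) : G.Point) (.vertex (G.src e)), ← hD, sub_zero,
        abs_of_pos hs.1, add_zero]
      congr 1; ring)
    (by
      rw [dist_self, ← hD, abs_sub_comm, abs_of_pos (by linarith [hs.2]), add_zero, min_comm]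
      congr 1; ring)
    (.inner e t ht) (.inner e s hs)
  rw [modify_inner, modify_inner, dist_comm] at this
  simp only [sub_self, abs_zero, sub_zero] at this
  rw [min_eq_left (a := (0 : ℝ)) (by linarith [len_pos (G := G) e]), sub_zero] at this
  exact (le_abs_self _).trans this

theorem dist_inner_inner_le (e : E) (s t : ℝ) (hs : 0 < s ∧ s < G.len e)
    (ht : 0 < t ∧ t < G.len e) :
    dist (.inner e s hs : G.Point) (.inner e t ht) ≤
      min |s - t| (G.len e + dist (.vertex (G.src e) : G.Point) (.vertex (G.tgt e)) - |s - t|) := by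
  have key : ∀ (s t : ℝ) (hs : 0 < s ∧ s < G.len e) (ht : 0 < t ∧ t < G.len e), s ≤ t →
      dist (.inner e s hs : G.Point) (.inner e t ht) ≤
        G.len e + dist (.vertex (G.src e) : G.Point) (.vertex (G.tgt e)) - |s - t| := by
    intro s t hs ht hst
    have h1 := dist_triangle4 (.inner e s hs : G.Point) (.vertex (G.src e)) (.vertex (G.tgt e))
      (.inner e t ht)
    have h2 := dist_inner_src_le e s hs
    have h3 := dist_inner_tgt_le e t ht
    rw [dist_comm] at h3
    rw [abs_sub_comm, abs_of_nonneg (by linarith)]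
    linarith
  refine le_min (dist_inner_le e s t hs ht) ?_
  rcases le_total s t with h | h
  · exact key s t hs ht h
  · rw [dist_comm, abs_sub_comm]; exact key t s ht hs h

/-- Give `v` the value 0 and every other vertex the value `c`, and interpolate linearly along edges.
The function is constant on loops and edges with distinct ends are long enough, so it is
1-Lipschitz. -/
theorem le_dist_vertex {c : ℝ} (hc0 : 0 ≤ c) (hc : ∀ e, G.src e ≠ G.tgt e → c ≤ G.len e)
    {v w : V} (hvw : v ≠ w) : c ≤ dist (.vertex v : G.Point) (.vertex w) := by
  classical
  let g : V → ℝ := fun u => if u = v then 0 else c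
  let f : G.Point → ℝ := fun p => match p with
    | .vertex u => g u
    | .inner e s _ => g (G.src e) + (g (G.tgt e) - g (G.src e)) * (s / G.len e)
  have key : ∀ e, ∀ t ∈ Icc 0 (G.len e),
      f (G.onEdge e t) = g (G.src e) + (g (G.tgt e) - g (G.src e)) * (t / G.len e) := by
    intro e t ht
    rcases onEdge_cases e ht with rfl | rfl | ⟨h, h'⟩
    · rw [onEdge_zero]; simp [f]
    · rw [onEdge_len, div_self (len_pos e).ne']; simp [f]
    · rw [h']
  have := abs_sub_le_dist (f := f) (fun e s hs t ht => by
    have h0 := len_pos (G := G) e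
    rw [key e s hs, key e t ht]
    have h1 : |g (G.tgt e) - g (G.src e)| ≤ G.len e := by
      by_cases he : G.src e = G.tgt e
      · simp [he, h0.le]
      · refine le_trans ?_ (hc e he)
        by_cases h2 : G.tgt e = v <;> by_cases h3 : G.src e = v <;>
          simp [g, h2, h3, abs_of_nonneg hc0, hc0]
    have h2 : g (G.src e) + (g (G.tgt e) - g (G.src e)) * (s / G.len e) -
        (g (G.src e) + (g (G.tgt e) - g (G.src e)) * (t / G.len e)) =
        (g (G.tgt e) - g (G.src e)) * ((s - t) / G.len e) := by ring
    rw [h2, abs_mul, abs_div, abs_of_pos h0]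
    calc _ ≤ G.len e * (|s - t| / G.len e) := by gcongr
      _ = |s - t| := by field_simp) (.vertex w) (.vertex v)
  have h1 : f (.vertex v) = 0 := by simp [f, g]
  have h2 : f (.vertex w) = c := by simp [f, g, hvw.symm]
  rw [h1, h2, sub_zero, abs_of_nonneg hc0, dist_comm] at this
  exact this

theorem isOpen_openEdge (e : E) : IsOpen (G.openEdge e) := by
  refine Metric.isOpen_iff.2 ?_
  rintro _ ⟨s, h, rfl⟩
  refine ⟨min s (G.len e - s), lt_min h.1 (by linarith [h.2]), fun y hy => ?_⟩
  by_contra hy'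
  have h1 := min_le_dist_inner e s h hy'
  rw [Metric.mem_ball, dist_comm] at hy
  have h2 : min s (G.len e - s) ≤
      min (s + dist (.vertex (G.src e)) y) (G.len e - s + dist (.vertex (G.tgt e)) y) :=
    min_le_min (by simp) (by simp)
  linarith

/-! ### Middle parts of edges, balls about vertices and their mutual distances. -/

/-- The part of the open edge `e` at distance more than `r` from its ends. -/
def midEdge (G : MetricGraph V E) (r : ℝ) (e : E) : Set G.Point :=
  {x | x ∈ G.openEdge e ∧ r < dist x (.vertex (G.src e)) ∧ r < dist x (.vertex (G.tgt e))}

theorem isOpen_midEdge (r : ℝ) (e : E) : IsOpen (G.midEdge r e) :=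
  (isOpen_openEdge e).inter ((isOpen_lt continuous_const (continuous_id.dist continuous_const)).inter
    (isOpen_lt continuous_const (continuous_id.dist continuous_const)))

theorem mem_closedBall_or_midEdge (r : ℝ) (hr : 0 ≤ r) (x : G.Point) :
    (∃ v, x ∈ Metric.closedBall (.vertex v : G.Point) r) ∨ ∃ e, x ∈ G.midEdge r e := by
  cases x with
  | vertex v => exact .inl ⟨v, by simpa using hr⟩
  | inner e s h =>
    by_contra! hne
    exact hne.2 e ⟨⟨s, h, rfl⟩, not_le.1 fun h' => hne.1 _ h', not_le.1 fun h' => hne.1 _ h'⟩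

/-- Leaving the open edge means passing one of its ends, and both are further than `r` away. -/
theorem lt_dist_of_mem_midEdge {r : ℝ} {e : E} {x y : G.Point} (hx : x ∈ G.midEdge r e)
    (hy : y ∉ G.openEdge e) : r + min (dist (.vertex (G.src e)) y) (dist (.vertex (G.tgt e)) y) <
      dist x y := by
  obtain ⟨⟨s, h, rfl⟩, h1, h2⟩ := hx
  refine lt_of_lt_of_le ?_ (min_le_dist_inner e s h hy)
  have h3 := h1.trans_le (dist_inner_src_le e s h)
  have h4 := h2.trans_le (dist_inner_tgt_le e s h)
  exact lt_min (add_lt_add_of_lt_of_le h3 (min_le_left _ _))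
    (add_lt_add_of_lt_of_le h4 (min_le_right _ _))

theorem lt_dist_midEdge_midEdge {r : ℝ} {e f : E} (hef : e ≠ f) {x y : G.Point}
    (hx : x ∈ G.midEdge r e) (hy : y ∈ G.midEdge r f) : 2 * r < dist x y := by
  have hy' : y ∉ G.openEdge e := by
    rintro ⟨s, h, rfl⟩
    obtain ⟨⟨t, h', h''⟩, -⟩ := hy
    cases h''
    exact hef rfl
  have h1 := lt_dist_of_mem_midEdge hx hy'
  have key : ∀ v, r ≤ dist (.vertex v) y := fun v => by
    have h2 := lt_dist_of_mem_midEdge hy (vertex_notMem_openEdge v f)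
    rw [dist_comm y] at h2
    have : 0 ≤ min (dist (.vertex (G.src f)) (.vertex v : G.Point))
      (dist (.vertex (G.tgt f)) (.vertex v : G.Point)) := le_min dist_nonneg dist_nonneg
    linarith
  have := le_min (key (G.src e)) (key (G.tgt e))
  linarith

/-- Reaching an end of `e` costs more than `r`, going on to `v` costs at least `c`, and stopping in
the ball saves at most `r`. -/
theorem lt_dist_midEdge_closedBall {r c : ℝ} {e : E} {v : V}
    (hc0 : 0 ≤ c) (hc : ∀ e, G.src e ≠ G.tgt e → c ≤ G.len e) (h1 : G.src e ≠ v)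
    (h2 : G.tgt e ≠ v) {x y : G.Point} (hx : x ∈ G.midEdge r e)
    (hy : y ∈ Metric.closedBall (.vertex v) r) : c < dist x y := by
  have h3 := lt_dist_of_mem_midEdge hx (vertex_notMem_openEdge v e)
  have h4 := le_min (le_dist_vertex hc0 hc h1) (le_dist_vertex hc0 hc h2)
  have h5 := dist_triangle x y (.vertex v)
  rw [Metric.mem_closedBall] at hy
  linarith

theorem le_dist_closedBall_closedBall {r c : ℝ} {v w : V}
    (hc0 : 0 ≤ c) (hc : ∀ e, G.src e ≠ G.tgt e → c ≤ G.len e) (hvw : v ≠ w)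
    {x y : G.Point} (hx : x ∈ Metric.closedBall (.vertex v) r)
    (hy : y ∈ Metric.closedBall (.vertex w) r) : c - 2 * r ≤ dist x y := by
  have h4 := le_dist_vertex hc0 hc hvw
  have h5 := dist_triangle4 (.vertex v) x y (.vertex w)
  rw [Metric.mem_closedBall] at hx hy
  rw [dist_comm] at hx
  linarith

end MetricGraph

/-! ### Cutting finite weighted multigraphs. -/

/-- A finite sum of small terms can be cut with small overshoot. -/
theorem exists_subset_sum_between {ι : Type*} (I : Finset ι) (w : ι → ℝ) (t c : ℝ) (ht : 0 ≤ t)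
    (hc : 0 < c) (hw : ∀ i ∈ I, w i ≤ c) (hI : t ≤ ∑ i ∈ I, w i) :
    ∃ J ⊆ I, t ≤ ∑ i ∈ J, w i ∧ ∑ i ∈ J, w i ≤ t + c := by
  classical
  induction I using Finset.induction_on with
  | empty =>
    rw [Finset.sum_empty] at hI
    exact ⟨∅, subset_rfl, by simpa using hI, by simp; linarith⟩
  | insert i I hi ih =>
    by_cases h : t ≤ ∑ i ∈ I, w i
    · obtain ⟨J, hJ, h1⟩ := ih (fun j hj => hw j (Finset.mem_insert_of_mem hj)) h
      exact ⟨J, hJ.trans (Finset.subset_insert _ _), h1⟩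
    · refine ⟨_, subset_rfl, hI, ?_⟩
      rw [Finset.sum_insert hi]
      have := hw i (Finset.mem_insert_self _ _)
      linarith

theorem exists_maximal_subset {ι : Type*} [DecidableEq ι] (I : Finset ι) (P : Finset ι → Prop)
    (h0 : P ∅) : ∃ J ⊆ I, P J ∧ ∀ i ∈ I, i ∉ J → ¬ P (insert i J) := by
  classical
  obtain ⟨J, hJ, hmax⟩ := Finset.exists_max_image (I.powerset.filter P) Finset.card
    ⟨∅, by simpa using h0⟩
  rw [Finset.mem_filter, Finset.mem_powerset] at hJ
  refine ⟨J, hJ.1, hJ.2, fun i hi hiJ hP => ?_⟩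
  have := hmax (insert i J) (by
    rw [Finset.mem_filter, Finset.mem_powerset]
    exact ⟨Finset.insert_subset hi hJ.1, hP⟩)
  rw [Finset.card_insert_of_notMem hiJ] at this
  omega

theorem sum_le_sum_add_of_subset_union {ι : Type*} [DecidableEq ι] {A B C : Finset ι} (w : ι → ℝ)
    (hw : ∀ i, 0 ≤ w i) (h : A ⊆ B ∪ C) : ∑ i ∈ A, w i ≤ ∑ i ∈ B, w i + ∑ i ∈ C, w i := by
  refine (Finset.sum_le_sum_of_subset_of_nonneg h fun i _ _ => hw i).trans ?_
  rw [← Finset.sum_union_inter]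
  exact le_add_of_nonneg_right (Finset.sum_nonneg fun i _ => hw i)

/-- The vertices of a finite weighted multigraph can be split into `Z` and `V₀ \ Z` in such a way
that `Z` and the edges inside `V₀ \ Z` have small total weight. -/
theorem exists_light_vertex_set {V E : Type*} [DecidableEq V] [DecidableEq E] (src tgt : E → V)
    (p : V → ℝ) (q : E → ℝ) (V₀ : Finset V) (E₀ : Finset E) (k τ : ℝ) (hk : 0 < k) (hτ : 0 < τ)
    (hp0 : ∀ v, 0 ≤ p v) (hp : ∀ v ∈ V₀, p v ≤ τ)
    (hsep : ∀ S ⊆ V₀, k ≤ ∑ v ∈ S, p v + ∑ e ∈ E₀ with src e ∈ S ∧ tgt e ∈ S, q e →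
      ∑ v ∈ V₀ \ S, p v + ∑ e ∈ E₀ with src e ∈ V₀ \ S ∧ tgt e ∈ V₀ \ S, q e < k) :
    ∃ Z ⊆ V₀, ∑ v ∈ Z, p v + ∑ e ∈ E₀ with src e ∈ V₀ \ Z ∧ tgt e ∈ V₀ \ Z, q e < k + τ := by
  -- Grow `S` as long as it weighs less than `k` together with the edges inside it.
  obtain ⟨S, hSV, hS, hmax⟩ := exists_maximal_subset V₀
    (fun S => ∑ v ∈ S, p v + ∑ e ∈ E₀ with src e ∈ S ∧ tgt e ∈ S, q e < k) (by simpa using hk)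
  by_cases hV : S = V₀
  · subst hV
    refine ⟨∅, by simp, ?_⟩
    have : 0 ≤ ∑ v ∈ S, p v := Finset.sum_nonneg fun v _ => hp0 v
    simp only [Finset.sum_empty, Finset.sdiff_empty]
    linarith
  obtain ⟨v, hv, hvS⟩ := Finset.exists_of_ssubset (hSV.ssubset_of_ne hV)
  have hS' := hsep (insert v S) (Finset.insert_subset hv hSV) (not_lt.1 (hmax v hv hvS))
  by_contra! hne
  -- If both candidates fail, add the two inequalities. `S` and `V₀ \ insert v S` with their inner
  -- edges contribute less than `2 * k`, and `p v`, counted twice, at most `2 * τ`.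
  have h1 := hne (insert v S) (Finset.insert_subset hv hSV)
  have h2 := hne (V₀ \ S) Finset.sdiff_subset
  have hY : V₀ \ S = insert v (V₀ \ insert v S) := by
    ext x; simp only [Finset.mem_sdiff, Finset.mem_insert]
    by_cases hx : x = v
    · subst hx; simp [hv, hvS]
    · simp [hx]
  rw [Finset.sdiff_sdiff_eq_self hSV, hY, Finset.sum_insert (by simp)] at h2
  rw [Finset.sum_insert hvS] at h1
  have := hp v hv
  linarith

/-- A finite weighted multigraph whose vertices and edges are light can be cut into two heavy
separated parts. -/
theorem false_of_no_separated_parts {V E : Type*} [DecidableEq V] [DecidableEq E] (src tgt : E → V)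
    (p : V → ℝ) (q : E → ℝ) (V₀ : Finset V) (E₀ : Finset E) (k τ : ℝ) (hk : 0 < k) (hτ : 0 < τ)
    (hp0 : ∀ v, 0 ≤ p v) (hq0 : ∀ e, 0 ≤ q e) (hp : ∀ v, p v ≤ τ) (hq : ∀ e, q e ≤ τ)
    (htot : 3 * k + 3 * τ ≤ ∑ v ∈ V₀, p v + ∑ e ∈ E₀, q e)
    (hsep : ∀ (S S' : Finset V) (F F' : Finset E), Disjoint S S' → Disjoint F F' →
      (∀ e ∈ F, src e ∉ S' ∧ tgt e ∉ S') → (∀ e ∈ F', src e ∉ S ∧ tgt e ∉ S) →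
      k ≤ ∑ v ∈ S, p v + ∑ e ∈ F, q e → ∑ v ∈ S', p v + ∑ e ∈ F', q e < k) : False := by
  obtain ⟨Z, hZ, hZk⟩ := exists_light_vertex_set src tgt p q V₀ E₀ k τ hk hτ hp0 (fun v _ => hp v)
    (fun S hS hS' => hsep S (V₀ \ S) _ _ Finset.disjoint_sdiff
      (by
        rw [Finset.disjoint_left]
        intro e he he'
        rw [Finset.mem_filter] at he he'
        exact (Finset.mem_sdiff.1 he'.2.1).2 he.2.1)
      (fun e he => by simp [(Finset.mem_filter.1 he).2])
      (fun e he => by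
        have := (Finset.mem_filter.1 he).2
        simp only [Finset.mem_sdiff] at this
        exact ⟨this.1.2, this.2.2⟩) hS')
  set Y := V₀ \ Z with hY
  -- A part of weight between `k` and `k + τ` finishes the proof: the opposite part weighs less than
  -- `k`, the discarded `Z` and edges inside `Y` less than `k + τ`, and `U` at most `τ`, in all less
  -- than `3 * k + 3 * τ`.
  have finish : ∀ (U S : Finset V) (F : Finset E), ∑ v ∈ U, p v ≤ τ → F ⊆ E₀ →
      (∀ e ∈ F, src e ∉ Y \ (U ∪ S) ∧ tgt e ∉ Y \ (U ∪ S)) →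
      (∀ e ∈ E₀, e ∉ F → (src e ∈ S ∨ tgt e ∈ S) → src e ∈ Y ∧ tgt e ∈ Y) →
      k ≤ ∑ v ∈ S, p v + ∑ e ∈ F, q e → ∑ v ∈ S, p v + ∑ e ∈ F, q e ≤ k + τ → False := by
    intro U S F hU hF hF1 hF2 h1 h2
    have h3 := hsep S (Y \ (U ∪ S)) F
      ((E₀ \ F).filter fun e => src e ∉ S ∧ tgt e ∉ S)
      (by
        rw [Finset.disjoint_left]; intro v hv hv'
        exact (Finset.mem_sdiff.1 hv').2 (Finset.mem_union_right _ hv))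
      (by
        rw [Finset.disjoint_left]; intro e he he'
        exact (Finset.mem_sdiff.1 (Finset.mem_filter.1 he').1).2 he)
      hF1 (fun e he => (Finset.mem_filter.1 he).2) h1
    have h4 : ∑ v ∈ V₀, p v ≤ ∑ v ∈ Y \ (U ∪ S), p v + (∑ v ∈ Z, p v +
        (∑ v ∈ U, p v + ∑ v ∈ S, p v)) := by
      refine (sum_le_sum_add_of_subset_union (B := Y \ (U ∪ S)) (C := Z ∪ (U ∪ S)) p hp0 ?_).trans ?_
      · intro v hv
        simp only [hY, Finset.mem_union, Finset.mem_sdiff]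
        tauto
      · gcongr
        refine (sum_le_sum_add_of_subset_union p hp0 subset_rfl).trans ?_
        gcongr
        exact sum_le_sum_add_of_subset_union p hp0 subset_rfl
    have h5 : ∑ e ∈ E₀, q e ≤ ∑ e ∈ (E₀ \ F).filter fun e => src e ∉ S ∧ tgt e ∉ S, q e +
        (∑ e ∈ F, q e + ∑ e ∈ E₀ with src e ∈ Y ∧ tgt e ∈ Y, q e) := by
      refine (sum_le_sum_add_of_subset_union
        (B := (E₀ \ F).filter fun e => src e ∉ S ∧ tgt e ∉ S)
        (C := F ∪ E₀.filter fun e => src e ∈ Y ∧ tgt e ∈ Y) q hq0 ?_).trans ?_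
      · intro e he
        have := hF2 e he
        simp only [Finset.mem_union, Finset.mem_sdiff, Finset.mem_filter]
        tauto
      · gcongr
        exact sum_le_sum_add_of_subset_union q hq0 subset_rfl
    linarith
  -- An edge not inside `Y` has at most one end in `Y`, so apart from the discarded edges the rest
  -- consists of stars about vertices of `Y` and edges avoiding `Y`. Whole stars are collected while
  -- the weight stays below `k`.
  obtain ⟨W, hWY, hW, hmax⟩ := exists_maximal_subset Y
    (fun W => ∑ v ∈ W, p v + ∑ e ∈ E₀ with (src e ∈ W ∨ tgt e ∈ W) ∧
      ¬ (src e ∈ Y \ W ∨ tgt e ∈ Y \ W), q e < k) (by simpa using hk)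
  set FW := E₀.filter fun e => (src e ∈ W ∨ tgt e ∈ W) ∧
    ¬ (src e ∈ Y \ W ∨ tgt e ∈ Y \ W) with hFW
  -- Single edges weigh at most `τ`, so adding some of `D` hits the window from `k` to `k + τ`.
  have add_edges : ∀ (U : Finset V) (D : Finset E), ∑ v ∈ U, p v ≤ τ → D ⊆ E₀ → Disjoint FW D →
      (∀ e ∈ D, src e ∉ Y \ (U ∪ W) ∧ tgt e ∉ Y \ (U ∪ W)) →
      k ≤ ∑ v ∈ W, p v + (∑ e ∈ FW, q e + ∑ e ∈ D, q e) → False := by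
    intro U D hU hD hdisj hD' hk'
    obtain ⟨J, hJ, h1, h2⟩ := exists_subset_sum_between D q
      (k - (∑ v ∈ W, p v + ∑ e ∈ FW, q e)) τ (by linarith) hτ (fun e _ => hq e) (by linarith)
    have h3 : ∑ e ∈ FW ∪ J, q e = ∑ e ∈ FW, q e + ∑ e ∈ J, q e :=
      Finset.sum_union (Finset.disjoint_of_subset_right hJ hdisj)
    refine finish U W (FW ∪ J) hU
      (Finset.union_subset (Finset.filter_subset _ _) (hJ.trans hD)) ?_ ?_
      (by linarith) (by linarith)
    · intro e he
      rcases Finset.mem_union.1 he with he | he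
      · have := (Finset.mem_filter.1 he).2
        simp only [Finset.mem_sdiff, Finset.mem_union] at this ⊢
        tauto
      · exact hD' e (hJ he)
    · intro e he he' heW
      have h4 : e ∉ FW := fun h => he' (Finset.mem_union_left _ h)
      rw [hFW, Finset.mem_filter] at h4
      have h5 : src e ∈ Y \ W ∨ tgt e ∈ Y \ W := by tauto
      simp only [Finset.mem_sdiff] at h5
      have h6 := @hWY (src e)
      have h7 := @hWY (tgt e)
      tauto
  by_cases hWeq : W = Y
  · refine add_edges ∅ (E₀ \ FW) (by simpa using hτ.le) Finset.sdiff_subset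
      Finset.disjoint_sdiff ?_ ?_
    · intro e _
      simp [hWeq]
    · have h1 : ∑ e ∈ E₀ \ FW, q e + ∑ e ∈ FW, q e = ∑ e ∈ E₀, q e :=
        Finset.sum_sdiff (Finset.filter_subset _ _)
      have h2 : ∑ v ∈ V₀, p v ≤ ∑ v ∈ W, p v + ∑ v ∈ Z, p v := by
        refine sum_le_sum_add_of_subset_union p hp0 fun v hv => ?_
        simp only [hWeq, hY, Finset.mem_union, Finset.mem_sdiff]
        tauto
      have h3 : 0 ≤ ∑ e ∈ E₀ with src e ∈ Y ∧ tgt e ∈ Y, q e := Finset.sum_nonneg fun e _ => hq0 e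
      linarith
  · obtain ⟨u, hu, huW⟩ := Finset.exists_of_ssubset (hWY.ssubset_of_ne hWeq)
    have hk' := not_lt.1 (hmax u hu huW)
    set D := E₀.filter fun e => (src e = u ∨ tgt e = u) ∧
      ¬ (src e ∈ Y \ (insert u W) ∨ tgt e ∈ Y \ (insert u W)) with hD
    have hdisj : Disjoint FW D := by
      rw [Finset.disjoint_left]
      intro e he he'
      rw [hFW, Finset.mem_filter] at he
      rw [hD, Finset.mem_filter] at he'
      simp only [Finset.mem_sdiff] at he
      rcases he'.2.1 with h | h <;> rw [h] at he <;> tauto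
    have hU : ∑ v ∈ {u}, p v ≤ τ := by simpa using hp u
    have hDU : ∀ e ∈ D, src e ∉ Y \ ({u} ∪ W) ∧ tgt e ∉ Y \ ({u} ∪ W) := by
      intro e he
      have := (Finset.mem_filter.1 he).2.2
      rw [Finset.insert_eq] at this
      tauto
    -- If the edges of the star of `u` already suffice, `u` itself is sacrificed as `U`. Otherwise
    -- `u` comes last, and its weight overshoots `k` by at most `τ`.
    by_cases hc : k ≤ ∑ v ∈ W, p v + (∑ e ∈ FW, q e + ∑ e ∈ D, q e)
    · exact add_edges {u} D hU (Finset.filter_subset _ _) hdisj hDU hc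
    · have hun : (E₀.filter fun e => (src e ∈ insert u W ∨ tgt e ∈ insert u W) ∧
          ¬ (src e ∈ Y \ insert u W ∨ tgt e ∈ Y \ insert u W)) = FW ∪ D := by
        ext e
        have h1 : src e = u → src e ∈ Y ∧ src e ∉ W := by rintro h; rw [h]; exact ⟨hu, huW⟩
        have h2 : tgt e = u → tgt e ∈ Y ∧ tgt e ∉ W := by rintro h; rw [h]; exact ⟨hu, huW⟩
        simp only [hFW, hD, Finset.mem_filter, Finset.mem_union, Finset.mem_insert,
          Finset.mem_sdiff]
        clear_value FW D Y
        clear hmax hk' hdisj hDU add_edges finish hsep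
        grind
      rw [hun, Finset.sum_insert huW, Finset.sum_union hdisj] at hk'
      have := hp u
      refine finish {u} (insert u W) (FW ∪ D) hU
        (Finset.union_subset (Finset.filter_subset _ _) (Finset.filter_subset _ _)) ?_ ?_ ?_ ?_
      · intro e he
        rw [← hun] at he
        have := (Finset.mem_filter.1 he).2.2
        simp only [Finset.mem_sdiff, Finset.mem_union, Finset.mem_insert,
          Finset.mem_singleton] at this ⊢
        tauto
      · intro e he he' heW
        rw [← hun, Finset.mem_filter] at he'
        have h5 : src e ∈ Y \ insert u W ∨ tgt e ∈ Y \ insert u W := by tauto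
        have h6 : ∀ v ∈ insert u W, v ∈ Y := fun v hv => by
          rcases Finset.mem_insert.1 hv with rfl | hv
          · exact hu
          · exact hWY hv
        have h7 := h6 (src e)
        have h8 := h6 (tgt e)
        simp only [Finset.mem_sdiff] at h5
        tauto
      · rw [Finset.sum_insert huW, Finset.sum_union hdisj]; linarith
      · rw [Finset.sum_insert huW, Finset.sum_union hdisj]; linarith

/-- If a finite family of weights has no two disjoint subfamilies of weight at least `θ`, then it
has small weight, or it is dominated by a single member. -/
theorem sum_lt_of_no_split {ι : Type*} [DecidableEq ι] (I : Finset ι) (w : ι → ℝ) (θ c : ℝ)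
    (hθ : 0 < θ) (hc : ∀ i, w i < c)
    (hsep : ∀ J J' : Finset ι, Disjoint J J' → θ ≤ ∑ i ∈ J, w i → ∑ i ∈ J', w i < θ) :
    ∑ i ∈ I, w i < 3 * θ ∨ ∑ i ∈ I, w i < c + θ := by
  by_contra! h
  -- A term of weight at least `θ` forces the rest below `θ`; without one, a subfamily of weight
  -- between `θ` and `2 * θ` leaves at least `θ`.
  by_cases hi : ∃ i ∈ I, θ ≤ w i
  · obtain ⟨i, hiI, hi⟩ := hi
    have := hsep {i} (I.erase i) (by simp) (by simpa using hi)
    have h2 := Finset.add_sum_erase I w hiI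
    have := hc i
    linarith [h.2]
  · push Not at hi
    obtain ⟨J, hJ, h1, h2⟩ := exists_subset_sum_between I w θ θ hθ.le hθ (fun i h => (hi i h).le)
      (by linarith [h.1])
    have := hsep J (I \ J) Finset.disjoint_sdiff h1
    have h3 := Finset.sum_sdiff (f := w) hJ
    linarith [h.1]

/-- The weights of the vertices and edges are small when one vertex is heavy and every family that
is separated from a heavy one is light. -/
theorem sum_add_sum_lt_of_heavy_vertex {V E : Type*} [DecidableEq V] [DecidableEq E]
    (p : V → ℝ) (q : E → ℝ) (V₀ : Finset V) (E₀ : Finset E) {κ κ' δ : ℝ} (hδ : 0 < δ)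
    (hκ' : 0 < κ') (hκκ' : κ' < κ) (hp : ∀ v, p v < κ / 3) (hq : ∀ e, q e < δ / 3)
    (hp0 : ∀ v, 0 ≤ p v) {v₀ : V} (hv₀ : δ / 3 ≤ p v₀)
    (hp1 : ∀ S S' : Finset V, Disjoint S S' → (κ - κ') / 4 ≤ ∑ v ∈ S, p v →
      ∑ v ∈ S', p v < (κ - κ') / 4)
    (hq1 : ∀ F F' : Finset E, Disjoint F F' → (κ - κ') / 4 ≤ ∑ e ∈ F, q e →
      ∑ e ∈ F', q e < (κ - κ') / 4)
    (hp2 : ∀ S S' : Finset V, Disjoint S S' → δ / 3 ≤ ∑ v ∈ S, p v → ∑ v ∈ S', p v < κ')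
    (hq2 : ∀ F F' : Finset E, Disjoint F F' → δ / 3 ≤ ∑ e ∈ F, q e → ∑ e ∈ F', q e < κ') :
    ∑ v ∈ V₀, p v + ∑ e ∈ E₀, q e < κ + 2 * δ / 3 := by
  -- For `κ' ≤ κ / 3` two errors `κ'` fit into `2 * κ / 3`. For `κ' > κ / 3` the threshold `(κ - κ')
  -- / 4` is below `κ / 6`, and the dichotomy of `sum_lt_of_no_split` suffices.
  rcases le_or_gt κ' (κ / 3) with h | h
  · have h1 : ∑ v ∈ V₀, p v < κ / 3 + κ' := by
      have h2 := hp2 {v₀} (V₀.erase v₀) (by simp) (by simpa using hv₀)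
      have h3 := sum_le_sum_add_of_subset_union (A := V₀) (B := {v₀}) (C := V₀.erase v₀) p hp0
        (fun v hv => by by_cases hvv : v = v₀ <;> simp [hvv, hv])
      rw [Finset.sum_singleton] at h3
      linarith [hp v₀]
    have h2 : ∑ e ∈ E₀, q e < κ' + 2 * δ / 3 := by
      by_contra! hc
      obtain ⟨F, hF, h3, h4⟩ := exists_subset_sum_between E₀ q (δ / 3) (δ / 3) (by linarith)
        (by linarith) (fun e _ => (hq e).le) (by linarith)
      have h5 := hq2 F (E₀ \ F) Finset.disjoint_sdiff h3
      have h6 := Finset.sum_sdiff (f := q) hF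
      linarith
    linarith
  · have h1 := sum_lt_of_no_split V₀ p _ _ (by linarith : 0 < (κ - κ') / 4) hp hp1
    have h2 := sum_lt_of_no_split E₀ q _ _ (by linarith : 0 < (κ - κ') / 4) hq hq1
    rcases h1 with h1 | h1 <;> rcases h2 with h2 | h2 <;> linarith

/-! ### Bounds for the separation distance and the partial diameter by explicit sets. -/

section Invariants

variable {X : Type*} [MetricSpace X] [MeasurableSpace X]

theorem ofReal_le_sepDist (ν : Measure X) [IsFiniteMeasure ν] {k₁ k₂ r : ℝ} (hk₁ : 0 < k₁)
    (hk₂ : 0 < k₂) {A B : Set X} (hA : MeasurableSet A) (hB : MeasurableSet B)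
    (h₁ : k₁ ≤ ν.real A) (h₂ : k₂ ≤ ν.real B) (h : ∀ x ∈ A, ∀ y ∈ B, r ≤ dist x y) :
    ENNReal.ofReal r ≤ sepDist ν k₁ k₂ := by
  have ne : ∀ {k : ℝ} {S : Set X}, 0 < k → k ≤ ν.real S → S.Nonempty := by
    intro k S hk hS
    by_contra hne
    rw [Set.not_nonempty_iff_eq_empty.1 hne, measureReal_empty] at hS
    linarith
  refine le_iSup_of_le A (le_iSup_of_le B (le_iSup_of_le ⟨hA, ne hk₁ h₁, ?_⟩
    (le_iSup_of_le ⟨hB, ne hk₂ h₂, ?_⟩ ?_)))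
  · exact (ENNReal.ofReal_le_iff_le_toReal (measure_ne_top _ _)).2 h₁
  · exact (ENNReal.ofReal_le_iff_le_toReal (measure_ne_top _ _)).2 h₂
  · refine le_iInf₂ fun x hx => le_iInf₂ fun y hy => ?_
    rw [edist_dist]
    exact ENNReal.ofReal_le_ofReal (h x hx y hy)

theorem partialDiam_le (ν : Measure X) [IsFiniteMeasure ν] {α r : ℝ}
    {Y : Set X} (hY : MeasurableSet Y) (h : α ≤ ν.real Y)
    (hd : ∀ x ∈ Y, ∀ y ∈ Y, dist x y ≤ r) : partialDiam ν α ≤ ENNReal.ofReal r := by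
  refine iInf_le_of_le Y (iInf_le_of_le hY (iInf_le_of_le
    ((ENNReal.ofReal_le_iff_le_toReal (measure_ne_top _ _)).2 h) (Metric.ediam_le fun x hx y hy => ?_)))
  rw [edist_dist]
  exact ENNReal.ofReal_le_ofReal (hd x hx y hy)

end Invariants

/-! ### Quantiles of bounded functions. -/

/-- Existence of a lower quantile. -/
theorem exists_lower_quantile {X : Type*} [MeasurableSpace X] (μ : Measure X) [IsFiniteMeasure μ]
    (g : X → ℝ) (hg : Measurable g) {M : ℝ} (hM : ∀ x, |g x| ≤ M) {θ : ℝ≥0∞} (hθ : 0 < θ)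
    (hμ : θ ≤ μ univ) :
    ∃ α, θ ≤ μ {x | g x ≤ α} ∧ μ {x | g x < α} ≤ θ ∧ ∀ t < α, μ {x | g x ≤ t} < θ := by
  set T := {t | θ ≤ μ {x | g x ≤ t}} with hT
  have hne : T.Nonempty := ⟨M, by
    rw [hT, mem_ofPred_eq, eq_univ_of_forall (s := {x | g x ≤ M}) fun x => (abs_le.1 (hM x)).2]
    exact hμ⟩
  have hbdd : BddBelow T := ⟨-M, fun t ht => by
    by_contra! hlt
    have : {x | g x ≤ t} = ∅ := by
      ext x
      have := (abs_le.1 (hM x)).1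
      simp only [mem_ofPred_eq, mem_empty_iff_false, iff_false, not_le]
      linarith
    rw [hT, mem_ofPred_eq, this, measure_empty] at ht
    exact hθ.not_ge ht⟩
  have hlt : ∀ t < sInf T, μ {x | g x ≤ t} < θ := fun t ht =>
    not_le.1 fun h => (csInf_le hbdd h).not_gt ht
  refine ⟨sInf T, ?_, ?_, hlt⟩
  · have h1 := tendsto_measure_biInter_gt (μ := μ) (s := fun t => {x | g x ≤ t}) (a := sInf T)
      (fun r _ => (measurableSet_le hg measurable_const).nullMeasurableSet)
      (fun i j _ hij x (hx : g x ≤ i) => hx.trans hij) ⟨sInf T + 1, by simp, measure_ne_top _ _⟩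
    have h2 : (⋂ r > sInf T, {x | g x ≤ r}) = {x | g x ≤ sInf T} := by
      ext x
      simp only [mem_iInter, mem_ofPred_eq]
      exact ⟨fun h => le_of_forall_gt_imp_ge_of_dense h, fun h r hr => h.trans hr.le⟩
    rw [h2] at h1
    refine ge_of_tendsto h1 (eventually_nhdsWithin_of_forall fun t ht => ?_)
    obtain ⟨u, hu, hut⟩ := exists_lt_of_csInf_lt hne ht
    exact le_trans hu (measure_mono fun x (hx : g x ≤ u) => hx.trans hut.le)
  · obtain ⟨u, hu, hu1, hu2⟩ := exists_seq_strictMono_tendsto (sInf T)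
    have h2 : {x | g x < sInf T} = ⋃ n, {x | g x ≤ u n} := by
      ext x
      simp only [mem_iUnion, mem_ofPred_eq]
      refine ⟨fun h => ?_, fun ⟨n, hn⟩ => hn.trans_lt (hu1 n)⟩
      obtain ⟨n, hn⟩ := ((tendsto_order.1 hu2).1 _ h).exists
      exact ⟨n, hn.le⟩
    have hmono : Monotone fun n => {x | g x ≤ u n} := fun i j hij x (hx : g x ≤ u i) =>
      hx.trans (hu.monotone hij)
    rw [h2, hmono.measure_iUnion]
    exact iSup_le fun n => (hlt _ (hu1 n)).le

/-- A bounded function takes values in an interval up to two small tails. -/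
theorem exists_quantile_interval {X : Type*} [MeasurableSpace X] (μ : Measure X)
    [IsFiniteMeasure μ] (g : X → ℝ) (hg : Measurable g) {M : ℝ} (hM : ∀ x, |g x| ≤ M)
    {θ : ℝ≥0∞} (hθ : 0 < θ) (hμ : 2 * θ ≤ μ univ) :
    ∃ α β, α ≤ β ∧ θ ≤ μ {x | g x ≤ α} ∧ θ ≤ μ {x | β ≤ g x} ∧
      μ {x | g x < α} ≤ θ ∧ μ {x | β < g x} ≤ θ := by
  have hμ' : θ ≤ μ univ := le_trans (by rw [two_mul]; exact le_self_add) hμ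
  obtain ⟨α, h1, h2, h3⟩ := exists_lower_quantile μ g hg hM hθ hμ'
  obtain ⟨β, h4, h5, h6⟩ := exists_lower_quantile μ (fun x => - g x) hg.neg
    (fun x => (abs_neg _).trans_le (hM x)) hθ hμ'
  refine ⟨α, -β, ?_, h1, ?_, h2, ?_⟩
  -- Otherwise a level strictly in between would have mass below `θ` on either side, although the
  -- two sides cover the space.
  · by_contra! hlt
    obtain ⟨t, ht1, ht2⟩ := exists_between hlt
    have h7 := h3 t ht2
    have h8 := h6 (-t) (by linarith)
    have h9 : μ univ ≤ μ {x | g x ≤ t} + μ {x | -g x ≤ -t} := by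
      refine le_trans (measure_mono fun x _ => ?_) (measure_union_le _ _)
      simpa using le_total (g x) t
    have := h9.trans_lt (ENNReal.add_lt_add h7 h8)
    rw [← two_mul] at this
    exact hμ.not_gt this
  · simpa only [neg_le] using h4
  · simpa only [neg_lt] using h5

/-! ### An open edge as a subset of a circle. -/

namespace MetricGraph

variable {V E : Type*} {G : MetricGraph V E}

/-- The arc length coordinate of an inner point of an edge. -/
def coord : G.Point → ℝ
  | .vertex _ => 0
  | .inner _ s _ => s

/-- A `1`-Lipschitz periodic function gives a `1`-Lipschitz function on a circle of
circumference `C`. -/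
theorem abs_periodic_sub_le {φ : ℝ → ℝ} (hφ : ∀ x y, |φ x - φ y| ≤ |x - y|)
    (hper : ∀ x, φ (x - 2 * Real.pi) = φ x) {C : ℝ} (hC : 0 < C) {s t : ℝ} (hst : |s - t| ≤ C) :
    |C / (2 * Real.pi) * φ (2 * Real.pi * s / C) - C / (2 * Real.pi) * φ (2 * Real.pi * t / C)| ≤
      min |s - t| (C - |s - t|) := by
  have hpi := Real.pi_pos
  have hc : 0 < C / (2 * Real.pi) := by positivity
  have key : ∀ {s t : ℝ}, t ≤ s → |s - t| ≤ C →
      |C / (2 * Real.pi) * φ (2 * Real.pi * s / C) - C / (2 * Real.pi) * φ (2 * Real.pi * t / C)| ≤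
      min |s - t| (C - |s - t|) := by
    intro s t h hst
    have habs : |s - t| = s - t := abs_of_nonneg (by linarith)
    rw [← mul_sub, abs_mul, abs_of_pos hc]
    refine le_min ?_ ?_
    · calc _ ≤ C / (2 * Real.pi) * |2 * Real.pi * s / C - 2 * Real.pi * t / C| :=
            mul_le_mul_of_nonneg_left (hφ _ _) hc.le
        _ = |s - t| := by
          rw [show 2 * Real.pi * s / C - 2 * Real.pi * t / C = 2 * Real.pi / C * (s - t) by ring,
            abs_mul, abs_of_pos (by positivity)]
          field_simp
    -- Moving one point back by a full period measures the complementary arc.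
    · rw [← hper (2 * Real.pi * s / C)]
      rw [habs] at hst ⊢
      calc _ ≤ C / (2 * Real.pi) * |2 * Real.pi * s / C - 2 * Real.pi - 2 * Real.pi * t / C| :=
            mul_le_mul_of_nonneg_left (hφ _ _) hc.le
        _ = C / (2 * Real.pi) * (2 * Real.pi / C * (C - (s - t))) := by
          rw [show 2 * Real.pi * s / C - 2 * Real.pi - 2 * Real.pi * t / C =
            -(2 * Real.pi / C * (C - (s - t))) by field_simp; ring, abs_neg,
            abs_of_nonneg (mul_nonneg (by positivity) (by linarith))]
        _ = _ := by field_simp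
  rcases le_total t s with h | h
  · exact key h hst
  · rw [abs_sub_comm, abs_sub_comm s t]
    exact key h (by rwa [abs_sub_comm])

/-- Comparison of arcs and chords on a circle of circumference `C`. -/
theorem min_sq_le_chord {C : ℝ} (hC : 0 < C) {s t : ℝ} (hst : |s - t| ≤ C) :
    (min |s - t| (C - |s - t|)) ^ 2 ≤ (Real.pi / 2) ^ 2 *
      ((C / (2 * Real.pi) * Real.cos (2 * Real.pi * s / C) -
          C / (2 * Real.pi) * Real.cos (2 * Real.pi * t / C)) ^ 2 +
        (C / (2 * Real.pi) * Real.sin (2 * Real.pi * s / C) -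
          C / (2 * Real.pi) * Real.sin (2 * Real.pi * t / C)) ^ 2) := by
  have hpi := Real.pi_pos
  set d := min |s - t| (C - |s - t|) with hd
  have hd0 : 0 ≤ d := le_min (abs_nonneg _) (by linarith)
  have hdC : d ≤ C / 2 := by
    rcases le_total |s - t| (C / 2) with h | h
    · exact (min_le_left _ _).trans h
    · exact (min_le_right _ _).trans (by linarith)
  have hsin : Real.sin (Real.pi * d / C) ^ 2 = Real.sin (Real.pi * (s - t) / C) ^ 2 := by
    have h1 : Real.sin (Real.pi * |s - t| / C) ^ 2 = Real.sin (Real.pi * (s - t) / C) ^ 2 := by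
      rcases abs_choice (s - t) with h | h <;> rw [h]
      rw [mul_neg, neg_div, Real.sin_neg, neg_sq]
    rw [← h1, hd]
    rcases min_choice |s - t| (C - |s - t|) with h | h <;> rw [h]
    rw [show Real.pi * (C - |s - t|) / C = Real.pi - Real.pi * |s - t| / C by field_simp,
      Real.sin_pi_sub]
  -- Jordan's inequality; `hdC` keeps the angle within a quarter turn.
  have hle : 2 * d / C ≤ Real.sin (Real.pi * d / C) := by
    have := Real.mul_le_sin (x := Real.pi * d / C) (by positivity) (by
      rw [div_le_div_iff₀ hC two_pos]; nlinarith)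
    refine le_trans (le_of_eq ?_) this
    field_simp
  have hchord : (Real.cos (2 * Real.pi * s / C) - Real.cos (2 * Real.pi * t / C)) ^ 2 +
      (Real.sin (2 * Real.pi * s / C) - Real.sin (2 * Real.pi * t / C)) ^ 2 =
      4 * Real.sin (Real.pi * (s - t) / C) ^ 2 := by
    have h1 : Real.cos (2 * (Real.pi * (s - t) / C)) =
        Real.cos (2 * Real.pi * s / C) * Real.cos (2 * Real.pi * t / C) +
        Real.sin (2 * Real.pi * s / C) * Real.sin (2 * Real.pi * t / C) := by
      rw [← Real.cos_sub]; congr 1; ring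
    rw [Real.cos_two_mul, Real.cos_sq'] at h1
    nlinarith [Real.sin_sq_add_cos_sq (2 * Real.pi * s / C),
      Real.sin_sq_add_cos_sq (2 * Real.pi * t / C)]
  have h2 : (2 * d / C) ^ 2 ≤ Real.sin (Real.pi * (s - t) / C) ^ 2 := by
    rw [← hsin]; exact pow_le_pow_left₀ (by positivity) hle 2
  calc d ^ 2 = (C / 2) ^ 2 * (2 * d / C) ^ 2 := by field_simp
    _ ≤ (C / 2) ^ 2 * Real.sin (Real.pi * (s - t) / C) ^ 2 := by gcongr
    _ = (Real.pi / 2) ^ 2 * ((C / (2 * Real.pi)) ^ 2 *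
        (4 * Real.sin (Real.pi * (s - t) / C) ^ 2)) := by field_simp; ring
    _ = _ := by rw [← hchord]; ring

/-- A measure with most of its mass on an open edge is concentrated like a measure on a circle. -/
theorem partialDiam_le_of_openEdge (ν : Measure G.Point) [IsFiniteMeasure ν] (e : E) {M θ : ℝ}
    (hM : 0 ≤ M) (hθ : 0 < θ) (h : M + 4 * θ ≤ ν.real (G.openEdge e)) :
    partialDiam ν M ≤ ENNReal.ofReal (Real.pi / Real.sqrt 2) * sepDist ν θ θ := by
  have hpi := Real.pi_pos
  have hcoef : 0 < Real.pi / Real.sqrt 2 := by positivity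
  by_cases htop : sepDist ν θ θ = ⊤
  · rw [htop, ENNReal.mul_top (by simpa using hcoef)]
    exact le_top
  set s := (sepDist ν θ θ).toReal with hs
  have hs' : sepDist ν θ θ = ENNReal.ofReal s := (ENNReal.ofReal_toReal htop).symm
  -- The connection of the two ends outside the edge acts as one more arc, of length their distance,
  -- so the edge lies isometrically in a circle of circumference `C`.
  set C := G.len e + dist (.vertex (G.src e) : G.Point) (.vertex (G.tgt e)) with hCdef
  have hC : 0 < C := add_pos_of_pos_of_nonneg (len_pos e) dist_nonneg
  set U := G.openEdge e with hU
  have hUm : MeasurableSet U := (isOpen_openEdge e).measurableSet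
  have hcd : ∀ x ∈ U, ∀ y ∈ U, |coord x - coord y| ≤ C ∧
      min |coord x - coord y| (C - |coord x - coord y|) = dist x y := by
    rintro _ ⟨a, ha, rfl⟩ _ ⟨b, hb, rfl⟩
    refine ⟨?_, le_antisymm (min_le_dist_inner_inner e a b ha hb) (dist_inner_inner_le e a b ha hb)⟩
    have : |a - b| ≤ G.len e := abs_sub_le_iff.2 ⟨by linarith [ha.2, hb.1], by linarith [ha.1, hb.2]⟩
    exact this.trans (le_add_of_nonneg_right dist_nonneg)
  have key : ∀ φ : ℝ → ℝ, (∀ x y, |φ x - φ y| ≤ |x - y|) → (∀ x, φ (x - 2 * Real.pi) = φ x) →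
      (∀ x, |φ x| ≤ 1) → ∃ Y ⊆ U, MeasurableSet Y ∧ ν.real (U \ Y) ≤ 2 * θ ∧ ∀ x ∈ Y, ∀ y ∈ Y,
        |C / (2 * Real.pi) * φ (2 * Real.pi * coord x / C) -
          C / (2 * Real.pi) * φ (2 * Real.pi * coord y / C)| ≤ s := by
    intro φ h1 h2 h3
    have hc : 0 < C / (2 * Real.pi) := by positivity
    have hLip : LipschitzOnWith 1
        (fun x : G.Point => C / (2 * Real.pi) * φ (2 * Real.pi * coord x / C)) U := by
      refine LipschitzOnWith.of_dist_le_mul fun x hx y hy => ?_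
      rw [Real.dist_eq, NNReal.coe_one, one_mul, ← (hcd x hx y hy).2]
      exact abs_periodic_sub_le h1 h2 hC (hcd x hx y hy).1
    -- The Lipschitz extension supplies measurability on the whole space and the truncation supplies
    -- boundedness; neither changes the values on `U`.
    obtain ⟨g₀, hg₀, hg₀U⟩ := hLip.extend_real
    set g : G.Point → ℝ := fun x => max (-(C / (2 * Real.pi))) (min (C / (2 * Real.pi)) (g₀ x))
      with hg
    have hgU : ∀ x ∈ U, g x = C / (2 * Real.pi) * φ (2 * Real.pi * coord x / C) := by
      intro x hx
      have h4 := abs_le.1 (h3 (2 * Real.pi * coord x / C))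
      rw [hg]
      simp only
      rw [← hg₀U hx]
      simp only
      rw [min_eq_right (by nlinarith), max_eq_right (by nlinarith)]
    have hgm : Measurable g :=
      measurable_const.max (measurable_const.min hg₀.continuous.measurable)
    have hgb : ∀ x, |g x| ≤ C / (2 * Real.pi) := fun x =>
      abs_le.2 ⟨le_max_left _ _, max_le (by linarith) (min_le_left _ _)⟩
    obtain ⟨α, β, hαβ, q1, q2, q3, q4⟩ := exists_quantile_interval (ν.restrict U) g hgm hgb
      (ENNReal.ofReal_pos.2 hθ) (by
        rw [Measure.restrict_apply_univ, show (2 : ℝ≥0∞) = ENNReal.ofReal 2 by simp,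
          ← ENNReal.ofReal_mul zero_le_two]
        exact (ENNReal.ofReal_le_iff_le_toReal (measure_ne_top _ _)).2 (by
          have : ν.real U = (ν U).toReal := rfl
          linarith))
    have m1 : MeasurableSet {x | g x ≤ α} := measurableSet_le hgm measurable_const
    have m2 : MeasurableSet {x | β ≤ g x} := measurableSet_le measurable_const hgm
    have m3 : MeasurableSet {x | g x < α} := measurableSet_lt hgm measurable_const
    have m4 : MeasurableSet {x | β < g x} := measurableSet_lt measurable_const hgm
    rw [Measure.restrict_apply m1] at q1
    rw [Measure.restrict_apply m2] at q2
    rw [Measure.restrict_apply m3] at q3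
    rw [Measure.restrict_apply m4] at q4
    have hsep : β - α ≤ s := by
      have := ofReal_le_sepDist ν (r := β - α) hθ hθ (m1.inter hUm) (m2.inter hUm)
        ((ENNReal.ofReal_le_iff_le_toReal (measure_ne_top _ _)).1 q1)
        ((ENNReal.ofReal_le_iff_le_toReal (measure_ne_top _ _)).1 q2)
        (by
          rintro x ⟨hx, hxU⟩ y ⟨hy, hyU⟩
          have h5 := hLip.dist_le_mul x hxU y hyU
          rw [Real.dist_eq, NNReal.coe_one, one_mul] at h5
          simp only [← hgU x hxU, ← hgU y hyU] at h5
          rw [abs_sub_comm] at h5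
          have := le_abs_self (g y - g x)
          simp only [mem_ofPred_eq] at hx hy
          linarith)
      rw [hs'] at this
      exact (ENNReal.ofReal_le_ofReal_iff ENNReal.toReal_nonneg).1 this
    refine ⟨U ∩ {x | α ≤ g x ∧ g x ≤ β}, inter_subset_left, hUm.inter
      ((measurableSet_le measurable_const hgm).inter (measurableSet_le hgm measurable_const)),
      ?_, ?_⟩
    · have hsub : U \ (U ∩ {x | α ≤ g x ∧ g x ≤ β}) ⊆
          ({x | g x < α} ∩ U) ∪ ({x | β < g x} ∩ U) := by
        rintro x ⟨hxU, hx⟩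
        by_cases h6 : α ≤ g x
        · exact .inr ⟨not_le.1 fun h7 => hx ⟨hxU, h6, h7⟩, hxU⟩
        · exact .inl ⟨not_le.1 h6, hxU⟩
      have r3 := ENNReal.toReal_le_of_le_ofReal hθ.le q3
      have r4 := ENNReal.toReal_le_of_le_ofReal hθ.le q4
      have := (measureReal_mono (μ := ν) hsub).trans (measureReal_union_le _ _)
      simp only [Measure.real] at this ⊢
      linarith
    · rintro x ⟨hxU, hx⟩ y ⟨hyU, hy⟩
      rw [← hgU x hxU, ← hgU y hyU]
      exact abs_sub_le_iff.2 ⟨by linarith [hx.2, hy.1], by linarith [hx.1, hy.2]⟩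
  -- Each of the two coordinates costs two tails of mass at most `θ`, which uses up the `4 * θ` in
  -- `h`.
  obtain ⟨Y, hYU, hYm, hY, hYd⟩ := key Real.cos
    (fun x y => by simpa [Real.dist_eq] using Real.lipschitzWith_cos.dist_le_mul x y)
    Real.cos_sub_two_pi Real.abs_cos_le_one
  obtain ⟨Z, hZU, hZm, hZ, hZd⟩ := key Real.sin
    (fun x y => by simpa [Real.dist_eq] using Real.lipschitzWith_sin.dist_le_mul x y)
    Real.sin_sub_two_pi Real.abs_sin_le_one
  rw [hs', ← ENNReal.ofReal_mul hcoef.le]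
  refine partialDiam_le ν (hYm.inter hZm) ?_ ?_
  · have hsub : U ⊆ (Y ∩ Z) ∪ ((U \ Y) ∪ (U \ Z)) := by
      intro x hx
      by_cases h1 : x ∈ Y <;> by_cases h2 : x ∈ Z <;> simp [h1, h2, hx]
    have h1 := (measureReal_mono (μ := ν) hsub).trans (measureReal_union_le _ _)
    have h2 := measureReal_union_le (μ := ν) (U \ Y) (U \ Z)
    linarith
  · rintro x ⟨hxY, hxZ⟩ y ⟨hyY, hyZ⟩
    obtain ⟨h1, h2⟩ := hcd x (hYU hxY) y (hYU hyY)
    have h3 := min_sq_le_chord hC h1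
    rw [h2] at h3
    have hs0 : 0 ≤ s := ENNReal.toReal_nonneg
    refine (le_abs_self _).trans (abs_le_of_sq_le_sq (h3.trans ?_) (by positivity))
    have h4 := sq_le_sq.2 ((hYd x hxY y hyY).trans (le_abs_self s))
    have h5 := sq_le_sq.2 ((hZd x hxZ y hyZ).trans (le_abs_self s))
    calc _ ≤ (Real.pi / 2) ^ 2 * (s ^ 2 + s ^ 2) := by gcongr
      _ = (Real.pi / Real.sqrt 2 * s) ^ 2 := by
        rw [mul_pow, div_pow, div_pow, Real.sq_sqrt zero_le_two]; ring

end MetricGraph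

/-! ### Uniformly separated families and separability. -/

/-- A uniformly separated family of sets carries its mass on finitely many members, up to `ε`. -/
theorem exists_finset_measure_rest_lt {X : Type*} [MetricSpace X] [MeasurableSpace X]
    (ν : Measure X) [IsFiniteMeasure ν] {S : Set X} (hS : TopologicalSpace.IsSeparable S)
    (hν : ν Sᶜ = 0) {ι : Type*} (P : ι → Set X) (hPm : ∀ i, MeasurableSet (P i)) {r : ℝ}
    (hr : 0 < r) (hP : ∀ i j, i ≠ j → ∀ x ∈ P i, ∀ y ∈ P j, r ≤ dist x y) {ε : ℝ} (hε : 0 < ε) :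
    ∃ s : Finset ι, ν.real (⋃ i, ⋃ (_ : i ∉ s), P i) < ε := by
  have hdisj : ∀ i j, i ≠ j → Disjoint (P i) (P j) := fun i j hij => by
    rw [Set.disjoint_left]
    intro x hx hx'
    have := hP i j hij x hx x hx'
    rw [dist_self] at this
    linarith
  -- The index type may be uncountable, but only members meeting `S` carry mass. Balls of radius `r
  -- / 2` about points chosen in them are disjoint, so there are countably many.
  set J := {i | (P i ∩ S).Nonempty} with hJ
  have hJc : J.Countable := by
    rcases isEmpty_or_nonempty X with hX | hX
    · have : J = ∅ := eq_empty_of_forall_notMem fun i (hi : (P i ∩ S).Nonempty) => hX.elim hi.some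
      rw [this]
      exact countable_empty
    choose! x hx using fun i (hi : i ∈ J) => hi
    have : TopologicalSpace.SeparableSpace S := hS.separableSpace
    refine Set.PairwiseDisjoint.countable_of_isOpen
      (s := fun i => (Subtype.val ⁻¹' Metric.ball (x i) (r / 2) : Set S)) ?_
      (fun i _ => Metric.isOpen_ball.preimage continuous_subtype_val)
      (fun i hi => ⟨⟨x i, (hx i hi).2⟩, by simpa using hr⟩)
    intro i hi j hj hij
    refine Set.disjoint_left.2 fun y hy hy' => ?_
    have h1 := hP i j hij _ (hx i hi).1 _ (hx j hj).1
    have h2 : dist (y : X) (x i) < r / 2 := hy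
    have h3 : dist (y : X) (x j) < r / 2 := hy'
    have h4 := dist_triangle_left (x i) (x j) y
    linarith
  have hsum : ∑' i, ν (P i) ≠ ∞ :=
    ((tsum_measure_le_measure_univ (fun i => (hPm i).nullMeasurableSet)
      fun i j hij => (hdisj i j hij).aedisjoint).trans_lt (measure_lt_top ν univ)).ne
  obtain ⟨s, hs⟩ := ((tendsto_order.1 (ENNReal.tendsto_tsum_compl_atTop_zero hsum)).2
    (ENNReal.ofReal ε) (ENNReal.ofReal_pos.2 hε)).exists
  refine ⟨s, ?_⟩
  rw [Measure.real, ← ENNReal.toReal_ofReal hε.le]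
  refine ENNReal.toReal_strict_mono ENNReal.ofReal_ne_top (lt_of_le_of_lt ?_ hs)
  have hsub : (⋃ i, ⋃ (_ : i ∉ s), P i) ⊆ Sᶜ ∪ ⋃ i ∈ {i | i ∈ J ∧ i ∉ s}, P i := by
    intro y hy
    simp only [mem_iUnion] at hy
    obtain ⟨i, hi, hy⟩ := hy
    by_cases hyS : y ∈ S
    · refine .inr ?_
      simp only [mem_iUnion]
      exact ⟨i, ⟨⟨y, hy, hyS⟩, hi⟩, hy⟩
    · exact .inl hyS
  calc _ ≤ ν Sᶜ + ν (⋃ i ∈ {i | i ∈ J ∧ i ∉ s}, P i) :=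
        (measure_mono hsub).trans (measure_union_le _ _)
    _ = ν (⋃ i ∈ {i | i ∈ J ∧ i ∉ s}, P i) := by rw [hν, zero_add]
    _ ≤ ∑' i : {i | i ∈ J ∧ i ∉ s}, ν (P i) :=
        measure_biUnion_le ν (hJc.mono fun i hi => hi.1) _
    _ ≤ ∑' i : {i // i ∉ s}, ν (P i) :=
        ENNReal.tsum_mono_subtype (fun i => ν (P i)) fun i hi => hi.2

/-- A uniform version of the bound `ν (P i) < τ` for a uniformly separated family. -/
theorem exists_uniform_bound_lt {X : Type*} [MetricSpace X] [MeasurableSpace X]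
    (ν : Measure X) [IsFiniteMeasure ν] {S : Set X} (hS : TopologicalSpace.IsSeparable S)
    (hν : ν Sᶜ = 0) {ι : Type*} (P : ι → Set X) (hPm : ∀ i, MeasurableSet (P i)) {r : ℝ}
    (hr : 0 < r) (hP : ∀ i j, i ≠ j → ∀ x ∈ P i, ∀ y ∈ P j, r ≤ dist x y) {τ : ℝ} (hτ : 0 < τ)
    (h : ∀ i, ν.real (P i) < τ) : ∃ τ₀ < τ, 0 < τ₀ ∧ ∀ i, ν.real (P i) ≤ τ₀ := by
  classical
  -- All members outside a finite set have mass below `τ / 2`, so the bound is a maximum of finitely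
  -- many numbers below `τ`.
  obtain ⟨s, hs⟩ := exists_finset_measure_rest_lt ν hS hν P hPm hr hP (half_pos hτ)
  have key : ∀ t : Finset ι, ∃ τ₀ < τ, τ / 2 ≤ τ₀ ∧ ∀ i ∈ t, ν.real (P i) ≤ τ₀ := by
    intro t
    induction t using Finset.induction_on with
    | empty => exact ⟨τ / 2, by linarith, le_rfl, by simp⟩
    | insert i t _ ih =>
      obtain ⟨τ₀, h1, h2, h3⟩ := ih
      refine ⟨max τ₀ (ν.real (P i)), max_lt h1 (h i), h2.trans (le_max_left _ _), fun j hj => ?_⟩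
      rcases Finset.mem_insert.1 hj with rfl | hj
      · exact le_max_right _ _
      · exact (h3 j hj).trans (le_max_left _ _)
  obtain ⟨τ₀, h1, h2, h3⟩ := key s
  refine ⟨τ₀, h1, by linarith, fun i => ?_⟩
  by_cases hi : i ∈ s
  · exact h3 i hi
  · refine le_trans ?_ (hs.le.trans h2)
    exact measureReal_mono (subset_iUnion₂ (s := fun i (_ : i ∉ s) => P i) i hi)
      (measure_ne_top _ _)

/-! ### From the measure to weights on vertices and edges. -/

namespace MetricGraph

variable {V E : Type*} {G : MetricGraph V E}

/-- The union of the closed balls of radius `r` around some vertices and of the middle parts of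
some edges. -/
def part (G : MetricGraph V E) (r : ℝ) (S : Finset V) (F : Finset E) : Set G.Point :=
  (⋃ v ∈ S, Metric.closedBall (.vertex v) r) ∪ ⋃ e ∈ F, G.midEdge r e

theorem measurableSet_part (r : ℝ) (S : Finset V) (F : Finset E) :
    MeasurableSet (G.part r S F) :=
  (S.measurableSet_biUnion fun _ _ => Metric.isClosed_closedBall.measurableSet).union
    (F.measurableSet_biUnion fun e _ => (isOpen_midEdge r e).measurableSet)

theorem half_le_dist_closedBall {a : ℝ} (ha : 0 < a)
    (hlen : ∀ e, G.src e ≠ G.tgt e → a ≤ G.len e) (v w : V) (hvw : v ≠ w) :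
    ∀ x ∈ Metric.closedBall (.vertex v : G.Point) (a / 4),
      ∀ y ∈ Metric.closedBall (.vertex w : G.Point) (a / 4), a / 2 ≤ dist x y := by
  intro x hx y hy
  have := le_dist_closedBall_closedBall ha.le hlen hvw hx hy
  linarith

theorem half_le_dist_midEdge {a : ℝ} (e f : E) (hef : e ≠ f) :
    ∀ x ∈ G.midEdge (a / 4) e, ∀ y ∈ G.midEdge (a / 4) f, a / 2 ≤ dist x y := by
  intro x hx y hy
  have := lt_dist_midEdge_midEdge hef hx hy
  linarith

theorem half_le_dist_part {a : ℝ} (ha : 0 < a) (hlen : ∀ e, G.src e ≠ G.tgt e → a ≤ G.len e)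
    {S S' : Finset V} {F F' : Finset E} (hS : Disjoint S S') (hF : Disjoint F F')
    (h₁ : ∀ e ∈ F, G.src e ∉ S' ∧ G.tgt e ∉ S') (h₂ : ∀ e ∈ F', G.src e ∉ S ∧ G.tgt e ∉ S) :
    ∀ x ∈ G.part (a / 4) S F, ∀ y ∈ G.part (a / 4) S' F', a / 2 ≤ dist x y := by
  have key : ∀ {e v}, G.src e ≠ v → G.tgt e ≠ v → ∀ {x y : G.Point}, x ∈ G.midEdge (a / 4) e →
      y ∈ Metric.closedBall (.vertex v) (a / 4) → a / 2 ≤ dist x y := by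
    intro e v h h' x y hx hy
    have := lt_dist_midEdge_closedBall ha.le hlen h h' hx hy
    linarith
  intro x hx y hy
  simp only [part, mem_union, mem_iUnion, exists_prop] at hx hy
  rcases hx with ⟨v, hv, hx⟩ | ⟨e, he, hx⟩ <;> rcases hy with ⟨w, hw, hy⟩ | ⟨f, hf, hy⟩
  · refine half_le_dist_closedBall ha hlen v w ?_ x hx y hy
    rintro rfl
    exact Finset.disjoint_left.1 hS hv hw
  · rw [dist_comm]
    refine key ?_ ?_ hy hx
    · rintro rfl; exact (h₂ f hf).1 hv
    · rintro rfl; exact (h₂ f hf).2 hv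
  · refine key ?_ ?_ hx hy
    · rintro rfl; exact (h₁ e he).1 hw
    · rintro rfl; exact (h₁ e he).2 hw
  · refine half_le_dist_midEdge e f ?_ x hx y hy
    rintro rfl
    exact Finset.disjoint_left.1 hF he hf

/-- All pieces are pairwise disjoint: an edge and one of its own ends by the definition of
`midEdge`, all others by separation. -/
theorem measureReal_part (ν : Measure G.Point) [IsFiniteMeasure ν] {a : ℝ} (ha : 0 < a)
    (hlen : ∀ e, G.src e ≠ G.tgt e → a ≤ G.len e) (S : Finset V) (F : Finset E) :
    ν.real (G.part (a / 4) S F) = ∑ v ∈ S, ν.real (Metric.closedBall (.vertex v) (a / 4)) +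
      ∑ e ∈ F, ν.real (G.midEdge (a / 4) e) := by
  have hdisj : ∀ {A B : Set G.Point}, (∀ x ∈ A, ∀ y ∈ B, a / 2 ≤ dist x y) → Disjoint A B := by
    intro A B h
    rw [Set.disjoint_left]
    intro x hx hx'
    have := h x hx x hx'
    rw [dist_self] at this
    linarith
  rw [part, measureReal_union ?_
    (F.measurableSet_biUnion fun e _ => (isOpen_midEdge _ e).measurableSet)
    (measure_ne_top _ _) (measure_ne_top _ _),
    measureReal_biUnion_finset (fun v _ w _ hvw => hdisj (half_le_dist_closedBall ha hlen v w hvw))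
      (fun v _ => Metric.isClosed_closedBall.measurableSet),
    measureReal_biUnion_finset (fun e _ f _ hef => hdisj (half_le_dist_midEdge e f hef))
      (fun e _ => (isOpen_midEdge _ e).measurableSet)]
  simp only [disjoint_iUnion_left, disjoint_iUnion_right]
  intro e _ v _
  by_cases h1 : G.src e = v
  · rw [Set.disjoint_left]
    rintro x hx ⟨-, h, -⟩
    rw [h1] at h
    exact h.not_ge hx
  by_cases h2 : G.tgt e = v
  · rw [Set.disjoint_left]
    rintro x hx ⟨-, -, h⟩
    rw [h2] at h
    exact h.not_ge hx
  refine hdisj fun x hx y hy => ?_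
  rw [dist_comm]
  have := lt_dist_midEdge_closedBall ha.le hlen h1 h2 hy hx
  linarith

/-- Separated parts cannot both be heavy if the separation distance is small. -/
theorem sum_lt_of_separated (ν : Measure G.Point) [IsFiniteMeasure ν] {a : ℝ} (ha : 0 < a)
    (hlen : ∀ e, G.src e ≠ G.tgt e → a ≤ G.len e) {k₁ k₂ : ℝ} (hk₁ : 0 < k₁) (hk₂ : 0 < k₂)
    (hsep : sepDist ν k₁ k₂ < ENNReal.ofReal (a / 2))
    {S S' : Finset V} {F F' : Finset E} (hS : Disjoint S S') (hF : Disjoint F F')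
    (h₁ : ∀ e ∈ F, G.src e ∉ S' ∧ G.tgt e ∉ S') (h₂ : ∀ e ∈ F', G.src e ∉ S ∧ G.tgt e ∉ S)
    (hk : k₁ ≤ ∑ v ∈ S, ν.real (Metric.closedBall (.vertex v) (a / 4)) +
      ∑ e ∈ F, ν.real (G.midEdge (a / 4) e)) :
    ∑ v ∈ S', ν.real (Metric.closedBall (.vertex v) (a / 4)) +
      ∑ e ∈ F', ν.real (G.midEdge (a / 4) e) < k₂ := by
  by_contra! hc
  rw [← measureReal_part ν ha hlen] at hk hc
  exact (ofReal_le_sepDist ν hk₁ hk₂ (measurableSet_part _ _ _) (measurableSet_part _ _ _) hk hc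
    (half_le_dist_part ha hlen hS hF h₁ h₂)).not_gt hsep

/-- Finitely many vertices and edges carry all of the measure up to `ε`. -/
theorem exists_finset_total (ν : Measure G.Point) [IsFiniteMeasure ν] {T : Set G.Point}
    (hT : TopologicalSpace.IsSeparable T) (hν : ν Tᶜ = 0) {a : ℝ} (ha : 0 < a)
    (hlen : ∀ e, G.src e ≠ G.tgt e → a ≤ G.len e) {ε : ℝ} (hε : 0 < ε) :
    ∃ (V₀ : Finset V) (E₀ : Finset E), ν.real univ - ε ≤
      ∑ v ∈ V₀, ν.real (Metric.closedBall (.vertex v) (a / 4)) +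
        ∑ e ∈ E₀, ν.real (G.midEdge (a / 4) e) := by
  obtain ⟨V₀, hV₀⟩ := exists_finset_measure_rest_lt ν hT hν
    (fun v : V => Metric.closedBall (.vertex v : G.Point) (a / 4))
    (fun v => Metric.isClosed_closedBall.measurableSet) (half_pos ha)
    (half_le_dist_closedBall ha hlen) (half_pos hε)
  obtain ⟨E₀, hE₀⟩ := exists_finset_measure_rest_lt ν hT hν (fun e : E => G.midEdge (a / 4) e)
    (fun e => (isOpen_midEdge _ e).measurableSet) (half_pos ha)
    half_le_dist_midEdge (half_pos hε)
  refine ⟨V₀, E₀, ?_⟩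
  rw [← measureReal_part ν ha hlen]
  have hsub : (univ : Set G.Point) ⊆ G.part (a / 4) V₀ E₀ ∪
      ((⋃ v, ⋃ (_ : v ∉ V₀), Metric.closedBall (.vertex v) (a / 4)) ∪
        ⋃ e, ⋃ (_ : e ∉ E₀), G.midEdge (a / 4) e) := by
    intro x _
    simp only [part, mem_union, mem_iUnion, exists_prop]
    rcases mem_closedBall_or_midEdge (a / 4) (by positivity) x with ⟨v, hv⟩ | ⟨e, he⟩
    · by_cases h : v ∈ V₀
      · exact .inl (.inl ⟨v, h, hv⟩)
      · exact .inr (.inl ⟨v, h, hv⟩)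
    · by_cases h : e ∈ E₀
      · exact .inl (.inr ⟨e, h, he⟩)
      · exact .inr (.inr ⟨e, h, he⟩)
  have h1 := (measureReal_mono (μ := ν) hsub).trans (measureReal_union_le _ _)
  have h2 := measureReal_union_le (μ := ν)
    (⋃ v, ⋃ (_ : v ∉ V₀), Metric.closedBall (.vertex v : G.Point) (a / 4))
    (⋃ e, ⋃ (_ : e ∉ E₀), G.midEdge (a / 4) e)
  linarith

end MetricGraph

/-! ### Growing a heavy ball. -/

namespace MetricGraph

variable {V E : Type*} {G : MetricGraph V E}

/-- A heavy ball grows to an almost full ball. -/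
theorem partialDiam_le_of_heavy_closedBall (ν : Measure G.Point) [IsFiniteMeasure ν] {k₁ k₂ r : ℝ}
    (hk₁ : 0 < k₁) (hk₂ : 0 < k₂) (hr : 0 ≤ r) (x₀ : G.Point)
    (h : k₁ ≤ ν.real (Metric.closedBall x₀ r)) :
    partialDiam ν (ν.real univ - k₂) ≤ ENNReal.ofReal (2 * r) + 2 * sepDist ν k₁ k₂ := by
  by_cases htop : sepDist ν k₁ k₂ = ⊤
  · simp [htop]
  set R := (sepDist ν k₁ k₂).toReal with hR
  have hR0 : 0 ≤ R := ENNReal.toReal_nonneg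
  have hR' : sepDist ν k₁ k₂ = ENNReal.ofReal R := (ENNReal.ofReal_toReal htop).symm
  refine ENNReal.le_of_forall_pos_le_add fun ε hε _ => ?_
  have hε' : (0 : ℝ) < ε := hε
  have hm : MeasurableSet (Metric.closedBall x₀ (r + (R + ε / 2))) :=
    Metric.isClosed_closedBall.measurableSet
  -- Points outside the enlarged ball are more than the separation distance away from the heavy one.
  have hO : ν.real (Metric.closedBall x₀ (r + (R + ε / 2)))ᶜ < k₂ := by
    by_contra! hc
    have := ofReal_le_sepDist ν (r := R + ε / 2) hk₁ hk₂ Metric.isClosed_closedBall.measurableSet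
      hm.compl h hc (fun x hx y hy => by
        rw [Metric.mem_closedBall] at hx
        rw [mem_compl_iff, Metric.mem_closedBall, not_le] at hy
        have := dist_triangle y x x₀
        rw [dist_comm y x] at this
        linarith)
    rw [hR'] at this
    have := (ENNReal.ofReal_le_ofReal_iff hR0).1 this
    linarith
  rw [measureReal_compl hm] at hO
  refine (partialDiam_le ν (r := 2 * (r + (R + ε / 2))) hm (by linarith) ?_).trans ?_
  · intro x hx y hy
    rw [Metric.mem_closedBall] at hx hy
    have := dist_triangle_right x y x₀
    linarith
  · rw [hR', show (2 : ℝ≥0∞) = ENNReal.ofReal 2 by simp, ← ENNReal.ofReal_mul zero_le_two,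
      ← ENNReal.ofReal_add (by positivity) (by positivity),
      show (ε : ℝ≥0∞) = ENNReal.ofReal ε by simp, ← ENNReal.ofReal_add (by positivity) hε'.le]
    exact ENNReal.ofReal_le_ofReal (by linarith)

/-- This converts a partial diameter of at most `a` into a separation distance below `a / 2`. -/
theorem two_le_pi_div_sqrt_two : 2 ≤ Real.pi / Real.sqrt 2 := by
  rw [le_div_iff₀ (by positivity)]
  have h1 := Real.pi_gt_three
  have h2 : Real.sqrt 2 ≤ 3 / 2 := by
    rw [Real.sqrt_le_left (by norm_num)]; norm_num
  linarith

end MetricGraph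

/-! ### The theorem. -/

open MetricGraph

theorem theorem3 {V : Type*} {E : Type*} (G : MetricGraph V E)
    (ν : Measure G.Point) [IsFiniteMeasure ν]
    (hν : ∃ S : Set G.Point, TopologicalSpace.IsSeparable S ∧ ν Sᶜ = 0)
    (m a κ κ' : ℝ) (hm : m = ν.real univ)
    (ha : 0 < a) (hκ : 0 < κ) (hκ' : 0 < κ') (hκκ' : κ' < κ)
    (haG : ENNReal.ofReal a < G.minLen)
    (hsep : max (2 * sepDist ν (κ / 3) (κ / 3)) (4 * sepDist ν ((m - κ) / 3) κ')
      < ENNReal.ofReal a) :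
    partialDiam ν (m - κ) ≤
      max (ENNReal.ofReal (a / 2) + 2 * sepDist ν (κ / 3) κ)
        (ENNReal.ofReal (Real.pi / Real.sqrt 2) *
          sepDist ν ((κ - κ') / 4) ((κ - κ') / 4)) := by
  classical
  obtain ⟨T, hT, hνT⟩ := hν
  have hlen : ∀ e, G.src e ≠ G.tgt e → a ≤ G.len e := fun e he =>
    (ENNReal.ofReal_le_ofReal_iff (len_pos e).le).1 (haG.le.trans (iInf₂_le e he))
  have hsep₁ : sepDist ν (κ / 3) (κ / 3) < ENNReal.ofReal (a / 2) := by
    by_contra! h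
    refine ((le_max_left _ _).trans_lt hsep).not_ge (le_trans ?_ (mul_le_mul_right h 2))
    rw [show (2 : ℝ≥0∞) = ENNReal.ofReal 2 by simp, ← ENNReal.ofReal_mul zero_le_two]
    exact ENNReal.ofReal_le_ofReal (by linarith)
  have hsep₂ : sepDist ν ((m - κ) / 3) κ' < ENNReal.ofReal (a / 4) := by
    by_contra! h
    refine ((le_max_right _ _).trans_lt hsep).not_ge (le_trans ?_ (mul_le_mul_right h 4))
    rw [show (4 : ℝ≥0∞) = ENNReal.ofReal 4 by simp, ← ENNReal.ofReal_mul zero_le_four]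
    exact ENNReal.ofReal_le_ofReal (by linarith)
  -- For `m ≤ κ` the empty set is admissible in the partial diameter.
  rcases le_or_gt (m - κ) 0 with hδ | hδ
  · refine (partialDiam_le ν (r := 0) MeasurableSet.empty (by simpa using hδ) (by simp)).trans ?_
    simp
  by_contra! hgoal
  have hp₁ : ∀ v, ν.real (Metric.closedBall (.vertex v : G.Point) (a / 4)) < κ / 3 := by
    intro v
    by_contra! h
    have := partialDiam_le_of_heavy_closedBall ν (k₂ := κ) (by positivity) hκ (by positivity) _ h
    rw [← hm, show 2 * (a / 4) = a / 2 by ring] at this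
    exact ((le_max_left _ _).trans_lt hgoal).not_ge this
  have hq : ∀ e, ν.real (G.midEdge (a / 4) e) < (m - κ) / 3 := by
    intro e
    by_contra! h
    have hU : MeasurableSet (G.openEdge e) := (isOpen_openEdge e).measurableSet
    -- The middle part is more than `a / 4` away from the complement of its open edge; this is where
    -- the factor 4 in the assumption enters.
    have h1 : ν.real (G.openEdge e)ᶜ < κ' := by
      by_contra! hc
      refine hsep₂.not_ge (ofReal_le_sepDist ν (by linarith) hκ'
        (isOpen_midEdge _ e).measurableSet hU.compl h hc fun x hx y hy => ?_)
      have h2 := lt_dist_of_mem_midEdge hx hy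
      have h3 : 0 ≤ min (dist (.vertex (G.src e)) y) (dist (.vertex (G.tgt e)) y) :=
        le_min dist_nonneg dist_nonneg
      linarith
    rw [measureReal_compl hU, ← hm] at h1
    exact ((le_max_right _ _).trans_lt hgoal).not_ge
      (partialDiam_le_of_openEdge ν e hδ.le (by linarith) (by linarith))
  have hp0 : ∀ v, 0 ≤ ν.real (Metric.closedBall (.vertex v : G.Point) (a / 4)) :=
    fun v => measureReal_nonneg
  by_cases hv : ∃ v, (m - κ) / 3 ≤ ν.real (Metric.closedBall (.vertex v : G.Point) (a / 4))
  · obtain ⟨v, hv⟩ := hv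
    have hD : partialDiam ν (m - κ) ≤ ENNReal.ofReal a := by
      have hU : MeasurableSet (Metric.ball (.vertex v : G.Point) (a / 2)) :=
        Metric.isOpen_ball.measurableSet
      have h1 : ν.real (Metric.ball (.vertex v : G.Point) (a / 2))ᶜ < κ' := by
        by_contra! hc
        refine hsep₂.not_ge (ofReal_le_sepDist ν (by linarith) hκ'
          Metric.isClosed_closedBall.measurableSet hU.compl hv hc fun x hx y hy => ?_)
        rw [Metric.mem_closedBall] at hx
        rw [mem_compl_iff, Metric.mem_ball, not_lt] at hy
        have := dist_triangle_left y (.vertex v) x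
        linarith
      rw [measureReal_compl hU, ← hm] at h1
      refine partialDiam_le ν hU (by linarith) fun x hx y hy => ?_
      rw [Metric.mem_ball] at hx hy
      have := dist_triangle_right x y (.vertex v)
      linarith
    have hsep₃ : sepDist ν ((κ - κ') / 4) ((κ - κ') / 4) < ENNReal.ofReal (a / 2) := by
      by_contra! h
      refine ((le_max_right _ _).trans_lt hgoal).not_ge (hD.trans ?_)
      calc ENNReal.ofReal a = ENNReal.ofReal 2 * ENNReal.ofReal (a / 2) := by
            rw [← ENNReal.ofReal_mul zero_le_two]; congr 1; ring
        _ ≤ _ := mul_le_mul' (ENNReal.ofReal_le_ofReal two_le_pi_div_sqrt_two) h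
    have hsep₂' := hsep₂.trans_le (ENNReal.ofReal_le_ofReal (by linarith : a / 4 ≤ a / 2))
    -- This `ε` leaves `m - ε = κ + 2 * (m - κ) / 3`, the bound that
    -- `sum_add_sum_lt_of_heavy_vertex` contradicts.
    obtain ⟨V₀, E₀, htot⟩ := exists_finset_total ν hT hνT ha hlen (ε := (m - κ) / 3) (by linarith)
    have hθ : 0 < (κ - κ') / 4 := by linarith
    have hδ' : 0 < (m - κ) / 3 := by linarith
    have vert : ∀ {k₁ k₂ : ℝ}, 0 < k₁ → 0 < k₂ → sepDist ν k₁ k₂ < ENNReal.ofReal (a / 2) →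
        ∀ S S' : Finset V, Disjoint S S' →
        k₁ ≤ ∑ v ∈ S, ν.real (Metric.closedBall (.vertex v : G.Point) (a / 4)) →
        ∑ v ∈ S', ν.real (Metric.closedBall (.vertex v : G.Point) (a / 4)) < k₂ := by
      intro k₁ k₂ h1 h2 h S S' hS hk
      simpa using sum_lt_of_separated ν ha hlen h1 h2 h hS (Finset.disjoint_empty_left ∅)
        (by simp) (by simp) (by simpa using hk)
    have edge : ∀ {k₁ k₂ : ℝ}, 0 < k₁ → 0 < k₂ → sepDist ν k₁ k₂ < ENNReal.ofReal (a / 2) →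
        ∀ F F' : Finset E, Disjoint F F' → k₁ ≤ ∑ e ∈ F, ν.real (G.midEdge (a / 4) e) →
        ∑ e ∈ F', ν.real (G.midEdge (a / 4) e) < k₂ := by
      intro k₁ k₂ h1 h2 h F F' hF hk
      simpa using sum_lt_of_separated ν ha hlen h1 h2 h (Finset.disjoint_empty_left ∅) hF
        (by simp) (by simp) (by simpa using hk)
    have := sum_add_sum_lt_of_heavy_vertex _ _ V₀ E₀ hδ hκ' hκκ' hp₁ hq hp0 hv
      (vert hθ hθ hsep₃) (edge hθ hθ hsep₃) (vert hδ' hκ' hsep₂') (edge hδ' hκ' hsep₂')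
    rw [← hm] at htot
    linarith
  · push Not at hv
    have hτ : 0 < (m - κ) / 3 := by linarith
    -- A uniform gap below `(m - κ) / 3` is needed to pay for the passage to finitely many pieces.
    obtain ⟨τ₁, hτ₁, hτ₁0, hp⟩ := exists_uniform_bound_lt ν hT hνT
      (fun v : V => Metric.closedBall (.vertex v : G.Point) (a / 4))
      (fun v => Metric.isClosed_closedBall.measurableSet) (half_pos ha)
      (half_le_dist_closedBall ha hlen) hτ hv
    obtain ⟨τ₂, hτ₂, -, hq'⟩ := exists_uniform_bound_lt ν hT hνT
      (fun e : E => G.midEdge (a / 4) e) (fun e => (isOpen_midEdge _ e).measurableSet)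
      (half_pos ha) half_le_dist_midEdge hτ hq
    have hτm : max τ₁ τ₂ < (m - κ) / 3 := max_lt hτ₁ hτ₂
    -- With this `ε` the finite total is at least `κ + 3 * max τ₁ τ₂`, which is `3 * k + 3 * τ` for
    -- `k = κ / 3` and `τ = max τ₁ τ₂`.
    obtain ⟨V₀, E₀, htot⟩ := exists_finset_total ν hT hνT ha hlen
      (ε := 3 * ((m - κ) / 3 - max τ₁ τ₂)) (by linarith)
    rw [← hm] at htot
    have hk : 0 < κ / 3 := by positivity
    exact false_of_no_separated_parts G.src G.tgt _ _ V₀ E₀ (κ / 3) (max τ₁ τ₂) hk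
      (lt_max_of_lt_left hτ₁0) hp0 (fun e => measureReal_nonneg)
      (fun v => (hp v).trans (le_max_left _ _)) (fun e => (hq' e).trans (le_max_right _ _))
      (by linarith) (fun S S' F F' hS hF h₁ h₂ =>
        sum_lt_of_separated ν ha hlen hk hk hsep₁ hS hF h₁ h₂)
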